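/- Let $k\ge 2$. A $k$-uniform hypergraph $G=(V,E)$ has a finite nonempty vertex set $V$ and a set $E$ of $k$-element subsets of $V$ (edges). A path of length $l$ is a sequence $u_1,e_1,u_2,\dots,e_l,u_{l+1}$ with distinct vertices $u_i$ and distinct edges $e_i$ such that $u_i,u_{i+1}\in e_i$ for all $i$; a cycle is such a sequence with $l\ge 2$, except that $u_{l+1}=u_1$ (and $u_1,\dots,u_l$ are distinct). A supertree is a connected hypergraph without cycles; the degree $d_v$ of $v$ is the number of edges containing $v$. Let $\mathcal Q(G)=\mathcal D(G)+\mathcal A(G)$ be the signless Laplacian tensor, of order $k$ and dimension $|V|$, where $\mathcal D(G)$ is diagonal with entries $d_v$, and $\mathcal A(G)$ has the entry $\frac1{(k-1)!}$ at $(i_1,\dots,i_k)$ if $\{i_1,\dots,i_k\}\in E$ and $0$ otherwise. An eigenvalue of $\mathcal Q(G)$ is a $\lambda\in\mathbb C$ for which some $x\in\mathbb C^{V}\setminus\{0\}$ satisfies $$\sum_{i_2,\dots,i_k\in V}\mathcal Q(G)_{i i_2\cdots i_k}\,x_{i_2}\cdots x_{i_k}=\lambda x_i^{k-1}\quad\text{for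 all } i\in V,$$ and $q(G)$, the signless Laplacian spectral radius, is the maximum of $|\lambda|$ over all eigenvalues $\lambda$. A supertree $G$ is a BFS-supertree if, for some root $v_0\in V$ with $h(v)$ denoting the distance from $v_0$ to $v$, there is a well-ordering $\prec$ of $V$ such that (a) $u\prec v$ implies $h(u)\le h(v)$; (b) $u\prec v$ implies $d_u\ge d_v$; (c) if $\{u,u_1\}\subseteq e_1\in E$, $\{v,v_1\}\subseteq e_2\in E$, $u\prec v$, $h(u)=h(u_1)+1$ and $h(v)=h(v_1)+1$, then $u_1\preceq v_1$; (d) if $e=\{u_1,\dots,u_k\}\in E$ with $u_1\prec u_2\prec\dots\prec u_k$, then no $v\in V\setminus e$ satisfies $u_i\prec v\prec u_{i+1}$ for some $2\le i\le k-1$. Theorem. Let $\pi=(d_0,\dots,d_{n-1})$ be the degree sequence (up to order) of some $k$-uniform supertree on $n$ vertices, and let $\mathbb S_\pi$ be the set of all $k$-uniform supertrees on $n$ vertices with degree sequence $\pi$. For every $G\in\mathbb S_\pi$ the maximum defining $q(G)$ exists. There is a BFS-supertree $G^*$ in $\mathbb S_\pi$, and it is unique up to isomorphism. For every $G\in\mathbb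 S_\pi$ we have $q(G)\le q(G^*)$, with equality if and only if $G$ is isomorphic to $G^*$. -/

import Mathlib

noncomputable section

namespace Hypergraph

variable {V W : Type*}

/-- `u 0, e 0, u 1, e 1, …, e (l - 1), u l` is a path of length `l` in `G`: the vertices are
distinct, the edges are distinct, and `e i` contains both `u i` and `u (i + 1)`. -/
def IsPath (G : Hypergraph V) {l : ℕ} (u : Fin (l + 1) → V) (e : Fin l → Set V) : Prop :=
  (∀ i, u i ∈ G.vertexSet) ∧ (∀ i, e i ∈ G.edgeSet) ∧
    Function.Injective u ∧ Function.Injective e ∧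
    ∀ i : Fin l, u i.castSucc ∈ e i ∧ u i.succ ∈ e i

/-- There is a path of length `l` from `a` to `b`. -/
def HasPath (G : Hypergraph V) (l : ℕ) (a b : V) : Prop :=
  ∃ (u : Fin (l + 1) → V) (e : Fin l → Set V), G.IsPath u e ∧ u 0 = a ∧ u (Fin.last l) = b

/-- Any two vertices are joined by a path. -/
def IsConnected (G : Hypergraph V) : Prop :=
  ∀ a ∈ G.vertexSet, ∀ b ∈ G.vertexSet, ∃ l, G.HasPath l a b

/-- The distance of two vertices: the length of a shortest path joining them. -/
def distance (G : Hypergraph V) (a b : V) : ℕ :=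
  sInf {l | G.HasPath l a b}

/-- `u 0, e 0, u 1, …, e (l - 1), u l = u 0` is a (Berge) cycle of length `l ≥ 2` in `G`:
`u 0, …, u (l - 1)` are distinct, the edges are distinct, and `e i` contains both `u i` and
`u (i + 1)`. In particular two distinct edges with two common vertices form a cycle. -/
def IsCycle (G : Hypergraph V) {l : ℕ} (u : Fin (l + 1) → V) (e : Fin l → Set V) : Prop :=
  2 ≤ l ∧ u (Fin.last l) = u 0 ∧ (∀ i, e i ∈ G.edgeSet) ∧
    Function.Injective (fun i : Fin l => u i.castSucc) ∧ Function.Injective e ∧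
    ∀ i : Fin l, u i.castSucc ∈ e i ∧ u i.succ ∈ e i

/-- `G` has no cycle. -/
def IsAcyclic (G : Hypergraph V) : Prop :=
  ∀ (l : ℕ) (u : Fin (l + 1) → V) (e : Fin l → Set V), ¬ G.IsCycle u e

/-- Every edge has precisely `k` vertices. -/
def IsUniform (G : Hypergraph V) (k : ℕ) : Prop :=
  ∀ e ∈ G.edgeSet, e.ncard = k

/-- A `k`-uniform supertree whose set of vertices is the whole (nonempty) type `V`. -/
structure IsSupertree (G : Hypergraph V) (k : ℕ) : Prop where
  nonempty : Nonempty V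
  vertexSet_eq : G.vertexSet = Set.univ
  uniform : G.IsUniform k
  connected : G.IsConnected
  acyclic : G.IsAcyclic

/-- The degree of a vertex: the number of edges that contain it. -/
def degree (G : Hypergraph V) (v : V) : ℕ :=
  {e | e ∈ G.edgeSet ∧ v ∈ e}.ncard

/-- The set of `k`-uniform supertrees on `n` labelled vertices whose list of degrees is, up to the
order of its entries, the sequence `d`. -/
def supertreesWithDegrees (k : ℕ) {n : ℕ} (d : Fin n → ℕ) : Set (Hypergraph (Fin n)) :=
  {G | G.IsSupertree k ∧ ∃ σ : Equiv.Perm (Fin n), ∀ i, G.degree (σ i) = d i}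

/-- Isomorphism of hypergraphs on the vertex types `V` and `W`. -/
def Isomorphic (G : Hypergraph V) (H : Hypergraph W) : Prop :=
  ∃ σ : V ≃ W, G.image σ = H

/-- `r` (read `r a b` as `a ≺ b`) is a breadth-first-search ordering of the vertices of `G` with
respect to the root `root` and the height function `h v = distance root v`. -/
structure IsBFSOrdering (G : Hypergraph V) (root : V) (r : V → V → Prop) : Prop where
  wellOrder : IsWellOrder V r
  height : ∀ u v, r u v → G.distance root u ≤ G.distance root v
  degree : ∀ u v, r u v → G.degree v ≤ G.degree u
  /-- The order of two vertices agrees weakly with the order of their parents (the parents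
  coincide for two children of the same vertex). -/
  parent : ∀ e₁ ∈ G.edgeSet, ∀ e₂ ∈ G.edgeSet, ∀ u ∈ e₁, ∀ u₁ ∈ e₁, ∀ v ∈ e₂, ∀ v₁ ∈ e₂,
    r u v → G.distance root u = G.distance root u₁ + 1 →
    G.distance root v = G.distance root v₁ + 1 → u₁ = v₁ ∨ r u₁ v₁
  /-- Apart from its first vertex, the vertices of an edge are consecutive: no vertex outside the
  edge lies between two vertices `b ≺ c` of the edge of which `b` is not the first one. -/
  consecutive : ∀ e ∈ G.edgeSet, ∀ a ∈ e, ∀ b ∈ e, ∀ c ∈ e, r a b → r b c →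
    ∀ v, r b v → r v c → v ∈ e

/-- `G` has a root and a breadth-first-search ordering with respect to it. -/
def HasBFSOrdering (G : Hypergraph V) : Prop :=
  ∃ (root : V) (r : V → V → Prop), G.IsBFSOrdering root r

/-- Complex tensors of order `k` (with `k ≥ 1`) and dimension `|V|`: the entry with the indices
`i, i₂, …, i_k` is `A i J`, where `J : Fin (k - 1) → V` lists `i₂, …, i_k`. -/
abbrev Tensor (k : ℕ) (V : Type*) := V → (Fin (k - 1) → V) → ℂ

/-- The vector `A x^{k-1}`, with `i`-th entry `∑ a_{i i₂ … i_k} x_{i₂} ⋯ x_{i_k}`. -/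
def Tensor.apply [Fintype V] {k : ℕ} (A : Tensor k V) (x : V → ℂ) (i : V) : ℂ :=
  open Classical in ∑ J : Fin (k - 1) → V, A i J * ∏ t, x (J t)

/-- `μ` is an eigenvalue of `A`: `A x^{k-1} = μ x^{[k-1]}` for some complex vector `x ≠ 0`. -/
def Tensor.IsEigenvalue [Fintype V] {k : ℕ} (A : Tensor k V) (μ : ℂ) : Prop :=
  ∃ x : V → ℂ, x ≠ 0 ∧ ∀ i, Tensor.apply A x i = μ * x i ^ (k - 1)

/-- The set of the moduli of the eigenvalues of `A`. -/
def Tensor.eigenvalueModuli [Fintype V] {k : ℕ} (A : Tensor k V) : Set ℝ :=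
  {t | ∃ μ : ℂ, Tensor.IsEigenvalue A μ ∧ t = ‖μ‖}

/-- The spectral radius of `A`, the largest modulus of an eigenvalue. -/
def Tensor.spectralRadius [Fintype V] {k : ℕ} (A : Tensor k V) : ℝ :=
  sSup (Tensor.eigenvalueModuli A)

open Classical in
/-- The adjacency tensor: the entry at `i, i₂, …, i_k` is `1 / (k - 1)!` if `{i, i₂, …, i_k}` is an
edge, and `0` otherwise. -/
def adjacencyTensor (G : Hypergraph V) (k : ℕ) : Tensor k V := fun i J =>
  if insert i (Set.range J) ∈ G.edgeSet then 1 / ((k - 1).factorial : ℂ) else 0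

open Classical in
/-- The diagonal tensor of the degrees. -/
def degreeTensor (G : Hypergraph V) (k : ℕ) : Tensor k V := fun i J =>
  if ∀ t, J t = i then (G.degree i : ℂ) else 0

/-- The signless Laplacian tensor. -/
def signlessLaplacian (G : Hypergraph V) (k : ℕ) : Tensor k V := fun i J =>
  G.degreeTensor k i J + G.adjacencyTensor k i J

/-- The signless Laplacian spectral radius of a `k`-uniform hypergraph. -/
def signlessLaplacianRadius [Fintype V] (G : Hypergraph V) (k : ℕ) : ℝ :=
  Tensor.spectralRadius (G.signlessLaplacian k)

end Hypergraph

end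

/-! For nonnegative `x`, let `energy k E x` be the form `x^T (Q x^{k-1})`. Its maximum on the
nonnegative vectors with `∑ v, x v ^ k = 1` is the spectral radius `ρ`, and for a connected family a
maximizer is strictly positive (`exists_isPerronPair`, `IsPerronPair.isGreatest`).

Let `E` maximize `ρ` among the finitely many trees with the given degrees, and let `x` be its
positive maximizer. Another such tree `E'` cannot have larger energy at `x`. If it has the same
energy, then `x` also satisfies the eigenvalue equations of `E'` for the same `ρ`, so its vertex
sums are those of `E` (`IsPerronPair.isExtremal`). Everything else about maximizers follows from
this property, `IsExtremal`, by two kinds of surgery. Swapping a vertex `u` of `e` with a vertex `v`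
of `f` changes the energy by `k (x u - x v) (B - A)`, where `A` and `B` are the products of `x` over
the rest of `e` and of `f`. Hence `u`, `v` are ordered by `x` as `e`, `f` are by their products
(`IsExtremal.exchange`). Moving edges from `v` to `u` shows that degrees are ordered like the
entries of `x` (`IsExtremal.deg_le_deg`).

Root the tree at a vertex of largest entry. The exchange inequalities show that entries do not
increase with height (`IsExtremal.le_of_height_lt`), and decreasing `x`, with ties broken by height
and then by the path to the root, is a breadth-first-search ordering (`IsExtremal.hasBFSOrdering`).

Conversely, such an ordering determines the tree from its degrees. Numbered from `0`, the non-root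
vertices split into consecutive blocks of `k - 1` siblings, one for each edge, and the parent of a
vertex is a monotone function whose fibre sizes are given by the degrees (`eq_of_isBFSOrdering_lt`).
So all trees with such an ordering are isomorphic, every maximizer is one of them, and a maximizer
exists by finiteness. This yields existence, uniqueness and the equality case together. -/

namespace Hypergraph

open Finset

/-! ### Hypertrees as connected families with an edge count, and their rootings -/

section Trees

variable {V : Type*}

/-- The graph whose edges are the pairs of distinct vertices with a common member of `E`. -/
def linkGraph (E : Finset (Finset V)) : SimpleGraph V where
  Adj a b := a ≠ b ∧ ∃ e ∈ E, a ∈ e ∧ b ∈ e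
  symm := ⟨fun _ _ h => ⟨h.1.symm, h.2.imp fun _ h' => ⟨h'.1, h'.2.2, h'.2.1⟩⟩⟩
  loopless := ⟨fun _ h => h.1 rfl⟩

lemma reachable_of_mem {E : Finset (Finset V)} {e : Finset V} (he : e ∈ E) {a b : V}
    (ha : a ∈ e) (hb : b ∈ e) : (linkGraph E).Reachable a b := by
  by_cases hab : a = b
  · rw [hab]
  · exact SimpleGraph.Adj.reachable ⟨hab, e, he, ha, hb⟩

lemma reachable_of_forall_mem {E E' : Finset (Finset V)}
    (h : ∀ e ∈ E, ∀ a ∈ e, ∀ b ∈ e, (linkGraph E').Reachable a b) {a b : V}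
    (hab : (linkGraph E).Reachable a b) : (linkGraph E').Reachable a b := by
  obtain ⟨w⟩ := hab
  induction w with
  | nil => rfl
  | cons hadj _ ih =>
    obtain ⟨-, e, he, h1, h2⟩ := hadj
    exact (h e he _ h1 _ h2).trans ih

lemma reachable_mono {E E' : Finset (Finset V)} (h : E ⊆ E') {a b : V}
    (hab : (linkGraph E).Reachable a b) : (linkGraph E').Reachable a b :=
  reachable_of_forall_mem (fun _ he _ ha _ hb => reachable_of_mem (h he) ha hb) hab

lemma connected_of_forall_mem {E E' : Finset (Finset V)} (hE : (linkGraph E).Connected)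
    (h : ∀ e ∈ E, ∀ a ∈ e, ∀ b ∈ e, (linkGraph E').Reachable a b) :
    (linkGraph E').Connected := by
  have := hE.nonempty
  exact ⟨fun a b => reachable_of_forall_mem h (hE.preconnected a b)⟩

lemma dist_le_dist_add_one {E : Finset (Finset V)} (hE : (linkGraph E).Connected) (r : V)
    {e : Finset V} (he : e ∈ E) {a b : V} (ha : a ∈ e) (hb : b ∈ e) :
    (linkGraph E).dist r b ≤ (linkGraph E).dist r a + 1 := by
  by_cases hab : a = b
  · subst hab; omega
  · have h1 := hE.dist_triangle (u := r) (v := a) (w := b)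
    have h2 : (linkGraph E).dist a b = 1 :=
      SimpleGraph.dist_eq_one_iff_adj.2 ⟨hab, e, he, ha, hb⟩
    omega

lemma exists_dist_eq_add_one {E : Finset (Finset V)} (hE : (linkGraph E).Connected) {r v : V}
    (hv : v ≠ r) : ∃ e ∈ E, v ∈ e ∧ ∃ u ∈ e,
      (linkGraph E).dist r v = (linkGraph E).dist r u + 1 := by
  obtain ⟨w, hw⟩ := hE.exists_walk_length_eq_dist v r
  obtain ⟨u, hadj, w', rfl⟩ := SimpleGraph.Walk.exists_eq_cons_of_ne hv w
  obtain ⟨e, he, h1, h2⟩ := hadj.2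
  refine ⟨e, he, h1, u, h2, ?_⟩
  have h3 := dist_le_dist_add_one hE r he h2 h1
  have h4 := SimpleGraph.dist_le w'
  rw [SimpleGraph.dist_comm (u := u)] at h4
  rw [SimpleGraph.dist_comm (u := v)] at hw
  simp only [SimpleGraph.Walk.length_cons] at hw
  omega

/-- In a connected family of sets, every member has a vertex closest to the root `r`, and every
vertex other than `r` belongs to a member whose closest vertex is closer to `r`. -/
lemma exists_parents {E : Finset (Finset V)} (hE : (linkGraph E).Connected) (r : V) :
    ∃ (p : Finset V → V) (pe : V → Finset V),
      (∀ e ∈ E, e.Nonempty → p e ∈ e ∧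
        ∀ u ∈ e, (linkGraph E).dist r (p e) ≤ (linkGraph E).dist r u) ∧
      ∀ v, v ≠ r → pe v ∈ E ∧ v ∈ pe v ∧
        (linkGraph E).dist r v = (linkGraph E).dist r (p (pe v)) + 1 := by
  have h1 : ∀ e : Finset V, ∃ p : V, e.Nonempty → p ∈ e ∧
      ∀ u ∈ e, (linkGraph E).dist r p ≤ (linkGraph E).dist r u := by
    intro e
    by_cases he : e.Nonempty
    · obtain ⟨p, hp, hp'⟩ := e.exists_min_image (fun v => (linkGraph E).dist r v) he
      exact ⟨p, fun _ => ⟨hp, hp'⟩⟩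
    · exact ⟨r, fun h => absurd h he⟩
  choose p hp using h1
  have h2 : ∀ v : V, ∃ e : Finset V, v ≠ r → e ∈ E ∧ v ∈ e ∧
        (linkGraph E).dist r v = (linkGraph E).dist r (p e) + 1 := by
    intro v
    by_cases hv : v = r
    · exact ⟨∅, fun h => absurd hv h⟩
    · obtain ⟨e, he, hve, u, hu, huv⟩ := exists_dist_eq_add_one hE hv
      refine ⟨e, fun _ => ⟨he, hve, ?_⟩⟩
      have h3 := hp e ⟨v, hve⟩
      have h4 := h3.2 u hu
      have h5 := dist_le_dist_add_one hE r he h3.1 hve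
      omega
  choose pe hpe using h2
  exact ⟨p, pe, fun e _ hne => hp e hne, hpe⟩

variable [DecidableEq V]

lemma card_sigma_erase {E : Finset (Finset V)} {p : Finset V → V}
    (hp : ∀ e ∈ E, e.Nonempty → p e ∈ e) :
    (E.sigma fun e => e.erase (p e)).card = ∑ e ∈ E, (e.card - 1) := by
  rw [card_sigma]
  refine sum_congr rfl fun e he => ?_
  rcases e.eq_empty_or_nonempty with rfl | hne
  · simp
  · rw [card_erase_of_mem (hp e he hne)]

variable [Fintype V]

/-- Assigning to each non-root vertex its parent edge is an injection into the pairs of an edge and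
a vertex of it other than the closest one. -/
lemma card_le_of_connected {E : Finset (Finset V)} (hE : (linkGraph E).Connected) :
    Fintype.card V ≤ ∑ e ∈ E, (e.card - 1) + 1 := by
  obtain ⟨r⟩ := hE.nonempty
  obtain ⟨p, pe, hp, hpe⟩ := exists_parents hE r
  rw [← card_sigma_erase fun e he hne => (hp e he hne).1]
  have h1 : (univ.erase r).card ≤ (E.sigma fun e => e.erase (p e)).card := by
    refine card_le_card_of_injOn (fun v => ⟨pe v, v⟩) ?_ ?_
    · intro v hv
      have hv' : v ≠ r := by simpa using hv
      obtain ⟨h2, h3, h4⟩ := hpe v hv'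
      simp only [coe_sigma, Set.mem_sigma_iff, mem_coe, mem_erase]
      refine ⟨h2, ?_, h3⟩
      intro h
      rw [← h] at h4
      omega
    · intro v _ w _ h
      simp only [Sigma.mk.injEq] at h
      exact eq_of_heq h.2
  rw [card_erase_of_mem (mem_univ r), card_univ] at h1
  omega

/-- `k`-uniform supertrees, given by a finite set of edges. -/
structure IsHypertree (k : ℕ) (E : Finset (Finset V)) : Prop where
  card_eq : ∀ e ∈ E, e.card = k
  connected : (linkGraph E).Connected
  count : Fintype.card V = E.card * (k - 1) + 1

/-- The data of a tree with root `r`: the heights `h` of the vertices, the closest vertex `p e` of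
each edge and the edge `pe v` that joins a vertex `v ≠ r` to its parent. -/
structure IsRooting (E : Finset (Finset V)) (r : V) (h : V → ℕ) (p : Finset V → V)
    (pe : V → Finset V) : Prop where
  height_root : h r = 0
  parent_mem : ∀ e ∈ E, p e ∈ e
  child : ∀ e ∈ E, ∀ v ∈ e, v ≠ p e → v ≠ r ∧ pe v = e ∧ h v = h (p e) + 1
  edge_mem : ∀ v, v ≠ r → pe v ∈ E ∧ v ∈ pe v ∧ v ≠ p (pe v)

lemma IsHypertree.isRooting {k : ℕ} (hk : 2 ≤ k) {E : Finset (Finset V)} (hE : IsHypertree k E)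
    (r : V) : ∃ p pe, IsRooting E r ((linkGraph E).dist r) p pe := by
  obtain ⟨p, pe, hp, hpe⟩ := exists_parents hE.connected r
  have hne : ∀ e ∈ E, e.Nonempty := fun e he => by
    rw [← card_pos, hE.card_eq e he]; omega
  have hpe' : ∀ v, v ≠ r → v ≠ p (pe v) := by
    intro v hv h
    have h4 := (hpe v hv).2.2
    rw [← h] at h4
    omega
  refine ⟨p, pe, SimpleGraph.dist_self, fun e he => (hp e he (hne e he)).1, ?_,
    fun v hv => ⟨(hpe v hv).1, (hpe v hv).2.1, hpe' v hv⟩⟩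
  -- In a tree the count makes the injection `v ↦ (pe v, v)` a bijection, so every vertex of `e`
  -- other than `p e` has `e` as its parent edge.
  have hcard : (E.sigma fun e => e.erase (p e)).card ≤ (univ.erase r).card := by
    rw [card_sigma_erase fun e he hne => (hp e he hne).1, card_erase_of_mem (mem_univ r),
      card_univ, hE.count, sum_congr rfl fun e he => by rw [hE.card_eq e he]]
    simp
  have hsurj := surj_on_of_inj_on_of_card_le (s := univ.erase r)
    (t := E.sigma fun e => e.erase (p e)) (fun v _ => ⟨pe v, v⟩)
    (fun v hv => by
      have hv' : v ≠ r := by simpa using hv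
      simp only [mem_sigma, mem_erase]
      exact ⟨(hpe v hv').1, hpe' v hv', (hpe v hv').2.1⟩)
    (fun v w _ _ h => by
      simp only [Sigma.mk.injEq] at h
      exact eq_of_heq h.2) hcard
  intro e he v hv hvp
  obtain ⟨w, hw, hw'⟩ := hsurj ⟨e, v⟩ (by simp [he, hv, hvp])
  simp only [Sigma.mk.injEq] at hw'
  obtain ⟨h1, h2⟩ := hw'
  obtain rfl := eq_of_heq h2
  have hv' : v ≠ r := by simpa using hw
  refine ⟨hv', h1.symm, ?_⟩
  rw [(hpe v hv').2.2, ← h1]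

/-- A map of the edges of a tree that does not enlarge them and keeps the family connected yields a
tree. -/
lemma IsHypertree.image {k : ℕ} (hk : 2 ≤ k) {E : Finset (Finset V)} (hE : IsHypertree k E)
    (φ : Finset V → Finset V) (hφ : ∀ e ∈ E, (φ e).card ≤ k)
    (hconn : (linkGraph (E.image φ)).Connected) :
    Set.InjOn φ E ∧ (∀ e ∈ E, (φ e).card = k) ∧ IsHypertree k (E.image φ) := by
  -- The connectivity bound for the image meets the exact count for `E`, so equality holds
  -- throughout: no two edges are merged and none shrinks.
  have h1 := card_le_of_connected hconn
  have h2 : ∑ e ∈ E.image φ, (e.card - 1) ≤ (E.image φ).card * (k - 1) := by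
    refine sum_le_card_nsmul _ _ _ fun f hf => ?_
    obtain ⟨e, he, rfl⟩ := mem_image.1 hf
    have := hφ e he
    omega
  have h3 : (E.image φ).card ≤ E.card := card_image_le
  rw [hE.count] at h1
  have h4 : E.card * (k - 1) ≤ (E.image φ).card * (k - 1) := by omega
  have h5 : E.card ≤ (E.image φ).card := Nat.le_of_mul_le_mul_right h4 (by omega)
  have h6 : (E.image φ).card = E.card := le_antisymm h3 h5
  have hinj : Set.InjOn φ E := card_image_iff.1 h6
  rw [sum_image hinj] at h1
  have h7 : ∀ e ∈ E, (φ e).card - 1 ≤ k - 1 := fun e he => by have := hφ e he; omega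
  have h8 : ∑ e ∈ E, ((φ e).card - 1) = ∑ _e ∈ E, (k - 1) := by
    refine le_antisymm (sum_le_sum h7) ?_
    rw [sum_const, smul_eq_mul]
    omega
  have h9 := (sum_eq_sum_iff_of_le h7).1 h8
  have h10 : ∀ e ∈ E, (φ e).card = k := fun e he => by have := h9 e he; omega
  refine ⟨hinj, h10, ?_, hconn, by rw [h6, hE.count]⟩
  intro f hf
  obtain ⟨e, he, rfl⟩ := mem_image.1 hf
  exact h10 e he

/-- Otherwise `a` could be deleted from `e` with the family staying connected, which
`IsHypertree.image` forbids because that edge would have fewer than `k` vertices. -/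
lemma IsHypertree.not_reachable_erase {k : ℕ} (hk : 2 ≤ k) {E : Finset (Finset V)}
    (hE : IsHypertree k E) {e : Finset V} (he : e ∈ E) {a b : V} (ha : a ∈ e) (hb : b ∈ e)
    (hab : a ≠ b) : ¬ (linkGraph (E.erase e)).Reachable a b := by
  intro h
  set φ : Finset V → Finset V := Function.update id e (e.erase a) with hφ
  have hφe : φ e = e.erase a := by simp [hφ]
  have hφg : ∀ g, g ≠ e → φ g = g := fun g hg => by simp [hφ, hg]
  have hsub : E.erase e ⊆ E.image φ := by
    intro g hg
    obtain ⟨h1, h2⟩ := mem_erase.1 hg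
    exact mem_image.2 ⟨g, h2, hφg g h1⟩
  have hmem : e.erase a ∈ E.image φ := mem_image.2 ⟨e, he, hφe⟩
  have hconn : (linkGraph (E.image φ)).Connected := by
    refine connected_of_forall_mem hE.connected fun g hg u hu v hv => ?_
    by_cases hge : g = e
    · subst hge
      have key : ∀ w ∈ g, (linkGraph (E.image φ)).Reachable w b := by
        intro w hw
        by_cases hwa : w = a
        · rw [hwa]; exact reachable_mono hsub h
        · exact reachable_of_mem hmem (mem_erase.2 ⟨hwa, hw⟩) (mem_erase.2 ⟨hab.symm, hb⟩)
      exact (key u hu).trans (key v hv).symm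
    · exact reachable_of_mem (hsub (mem_erase.2 ⟨hge, hg⟩)) hu hv
  have hcard : ∀ g ∈ E, (φ g).card ≤ k := by
    intro g hg
    by_cases hge : g = e
    · rw [hge, hφe]; exact (card_erase_le).trans (hE.card_eq e he).le
    · rw [hφg g hge, hE.card_eq g hg]
  have h1 := (hE.image hk φ hcard hconn).2.1 e he
  rw [hφe, card_erase_of_mem ha, hE.card_eq e he] at h1
  omega

end Trees

/-! ### Supertrees of the statement correspond to hypertrees -/

section OfEdges

variable {V : Type*}

/-- The hypergraph on the whole type `V` with a given finite set of edges. -/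
def ofEdges (E : Finset (Finset V)) : Hypergraph V where
  vertexSet := Set.univ
  edgeSet := {s | ∃ e ∈ E, (e : Set V) = s}
  subset_vertexSet_of_mem_edgeSet' := fun _ _ => Set.subset_univ _

lemma mem_edgeSet_ofEdges {E : Finset (Finset V)} {s : Set V} :
    s ∈ (ofEdges E).edgeSet ↔ ∃ e ∈ E, (e : Set V) = s := Iff.rfl

lemma coe_mem_edgeSet_ofEdges {E : Finset (Finset V)} {e : Finset V} :
    (e : Set V) ∈ (ofEdges E).edgeSet ↔ e ∈ E := by
  simp [mem_edgeSet_ofEdges]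

lemma exists_eq_ofEdges [Finite V] {G : Hypergraph V} (hG : G.vertexSet = Set.univ) :
    ∃ E, G = ofEdges E := by
  have := Fintype.ofFinite V
  classical
  refine ⟨univ.filter fun e : Finset V => (e : Set V) ∈ G.edgeSet, Hypergraph.ext hG ?_⟩
  ext s
  rw [mem_edgeSet_ofEdges]
  constructor
  · intro hs
    exact ⟨s.toFinite.toFinset, by simpa using hs, by simp⟩
  · rintro ⟨e, he, rfl⟩
    simpa using he

lemma isUniform_ofEdges {E : Finset (Finset V)} {k : ℕ} :
    (ofEdges E).IsUniform k ↔ ∀ e ∈ E, e.card = k := by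
  simp [IsUniform, mem_edgeSet_ofEdges]

lemma degree_ofEdges [DecidableEq V] (E : Finset (Finset V)) (v : V) :
    (ofEdges E).degree v = (E.filter fun e => v ∈ e).card := by
  have h : {s : Set V | s ∈ (ofEdges E).edgeSet ∧ v ∈ s} =
      (fun e : Finset V => (e : Set V)) '' (E.filter fun e => v ∈ e : Finset (Finset V)) := by
    ext s
    simp only [Set.mem_ofPred_eq, mem_edgeSet_ofEdges, Set.mem_image, mem_coe, mem_filter]
    constructor
    · rintro ⟨⟨e, he, rfl⟩, hv⟩
      exact ⟨e, ⟨he, hv⟩, rfl⟩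
    · rintro ⟨e, ⟨he, hv⟩, rfl⟩
      exact ⟨⟨e, he, rfl⟩, hv⟩
  rw [degree, h, Set.ncard_image_of_injective _ coe_injective, Set.ncard_coe_finset]

lemma exists_walk_length_le {E : Finset (Finset V)} {l : ℕ} {u : Fin (l + 1) → V}
    (h : ∀ i : Fin l, ∃ e ∈ E, u i.castSucc ∈ e ∧ u i.succ ∈ e) (i : Fin (l + 1)) :
    ∃ w : (linkGraph E).Walk (u 0) (u i), w.length ≤ i := by
  induction i using Fin.induction with
  | zero => exact ⟨.nil, by simp⟩
  | succ i ih =>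
    obtain ⟨w, hw⟩ := ih
    obtain ⟨e, he, h1, h2⟩ := h i
    by_cases huv : u i.castSucc = u i.succ
    · exact ⟨w.copy rfl huv, by simp at hw ⊢; omega⟩
    · have hadj : (linkGraph E).Adj (u i.castSucc) (u i.succ) := ⟨huv, e, he, h1, h2⟩
      refine ⟨w.concat hadj, ?_⟩
      rw [SimpleGraph.Walk.length_concat]
      simp at hw ⊢; omega

lemma HasPath.exists_walk {E : Finset (Finset V)} {l : ℕ} {a b : V}
    (h : (ofEdges E).HasPath l a b) : ∃ w : (linkGraph E).Walk a b, w.length ≤ l := by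
  obtain ⟨u, e, ⟨-, he, -, -, hue⟩, rfl, rfl⟩ := h
  refine exists_walk_length_le (fun i => ?_) (Fin.last l)
  obtain ⟨f, hf, hfe⟩ := mem_edgeSet_ofEdges.1 (he i)
  refine ⟨f, hf, ?_, ?_⟩
  · have := (hue i).1; rwa [← hfe] at this
  · have := (hue i).2; rwa [← hfe] at this

/-- A shortest walk has distinct vertices, and also distinct edges: were the steps `i < j` in the
same edge, one could jump from vertex `i` directly to vertex `j + 1`. -/
lemma hasPath_dist {E : Finset (Finset V)} {a b : V} (h : (linkGraph E).Reachable a b) :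
    (ofEdges E).HasPath ((linkGraph E).dist a b) a b := by
  obtain ⟨p, hp⟩ := h.exists_walk_length_eq_dist
  have hpath := p.isPath_of_length_eq_dist hp
  rw [← hp]
  have hadj : ∀ i : Fin p.length, ∃ e ∈ E, p.getVert i ∈ e ∧ p.getVert (i + 1) ∈ e :=
    fun i => (p.adj_getVert_succ i.2).2
  choose e he h1 h2 using hadj
  have hinj : ∀ i j : ℕ, i ≤ p.length → j ≤ p.length → p.getVert i = p.getVert j → i = j :=
    fun i j hi hj hij => hpath.getVert_injOn hi hj hij
  have hlt : ∀ i j : Fin p.length, i < j → e i ≠ e j := by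
    intro i j hij heq
    have hj := j.2
    have hij' : (i : ℕ) < j := hij
    have hadj : (linkGraph E).Adj (p.getVert i) (p.getVert (j + 1)) := by
      refine ⟨fun hc => ?_, e i, he i, h1 i, ?_⟩
      · have := hinj i (j + 1) (by omega) (by omega) hc
        omega
      · rw [heq]; exact h2 j
    have := SimpleGraph.dist_le ((p.take i).append (.cons hadj (p.drop (j + 1))))
    rw [← hp] at this
    simp only [SimpleGraph.Walk.length_append, SimpleGraph.Walk.length_cons,
      SimpleGraph.Walk.take_length, SimpleGraph.Walk.drop_length] at this
    omega
  refine ⟨fun i => p.getVert i, fun i => (e i : Set V), ⟨fun _ => Set.mem_univ _,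
    fun i => coe_mem_edgeSet_ofEdges.2 (he i), ?_, ?_, ?_⟩, by simp, by simp⟩
  · intro i j hij
    exact Fin.ext (hinj i j (by omega) (by omega) hij)
  · intro i j hij
    have hij' : e i = e j := coe_injective hij
    by_contra hne
    rcases lt_or_gt_of_ne hne with h | h
    · exact hlt i j h hij'
    · exact hlt j i h hij'.symm
  · exact fun i => ⟨by simpa using h1 i, by simpa using h2 i⟩

lemma isConnected_ofEdges {E : Finset (Finset V)} :
    (ofEdges E).IsConnected ↔ (linkGraph E).Preconnected := by
  constructor
  · intro h a b
    obtain ⟨l, hl⟩ := h a (Set.mem_univ _) b (Set.mem_univ _)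
    obtain ⟨w, -⟩ := hl.exists_walk
    exact ⟨w⟩
  · exact fun h a _ b _ => ⟨_, hasPath_dist (h a b)⟩

lemma distance_ofEdges {E : Finset (Finset V)} (hE : (linkGraph E).Connected) (a b : V) :
    (ofEdges E).distance a b = (linkGraph E).dist a b := by
  have h1 := hasPath_dist (hE.preconnected a b)
  refine le_antisymm (Nat.sInf_le h1) (le_csInf ⟨_, h1⟩ fun l hl => ?_)
  obtain ⟨w, hw⟩ := HasPath.exists_walk hl
  exact (SimpleGraph.dist_le w).trans hw

variable [DecidableEq V]

/-- A path from `a` to `b` that avoids `e` is closed to a cycle by `e`. -/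
lemma not_isAcyclic_of_reachable_erase {E : Finset (Finset V)} {e : Finset V} (he : e ∈ E)
    {a b : V} (ha : a ∈ e) (hb : b ∈ e) (hab : a ≠ b)
    (h : (linkGraph (E.erase e)).Reachable a b) : ¬ (ofEdges E).IsAcyclic := by
  intro hac
  have hpath := hasPath_dist h
  have hpos := h.pos_dist_of_ne hab
  generalize (linkGraph (E.erase e)).dist a b = l at hpath hpos
  obtain ⟨u, f, ⟨-, hf, hu, hfi, huf⟩, h0, hl⟩ := hpath
  have hfE : ∀ i, f i ∈ (ofEdges E).edgeSet ∧ f i ≠ e := by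
    intro i
    obtain ⟨g, hg, hge⟩ := mem_edgeSet_ofEdges.1 (hf i)
    obtain ⟨h1, h2⟩ := mem_erase.1 hg
    rw [← hge]
    exact ⟨coe_mem_edgeSet_ofEdges.2 h2, fun h => h1 (coe_injective h)⟩
  refine hac (l + 1) (Fin.snoc (α := fun _ => V) u a)
    (Fin.snoc (α := fun _ => Set V) f (e : Set V)) ⟨by omega, ?_, ?_, ?_, ?_, ?_⟩
  · rw [Fin.snoc_last, ← Fin.castSucc_zero, Fin.snoc_castSucc, h0]
  · intro i
    refine Fin.lastCases ?_ (fun i => ?_) i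
    · rw [Fin.snoc_last]; exact coe_mem_edgeSet_ofEdges.2 he
    · rw [Fin.snoc_castSucc]; exact (hfE i).1
  · intro i j hij
    simp only [Fin.snoc_castSucc] at hij
    exact hu hij
  · intro i j hij
    induction i using Fin.lastCases with
    | last =>
      induction j using Fin.lastCases with
      | last => rfl
      | cast j =>
        rw [Fin.snoc_last, Fin.snoc_castSucc] at hij
        exact absurd hij.symm (hfE j).2
    | cast i =>
      induction j using Fin.lastCases with
      | last =>
        rw [Fin.snoc_last, Fin.snoc_castSucc] at hij
        exact absurd hij (hfE i).2
      | cast j =>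
        rw [Fin.snoc_castSucc, Fin.snoc_castSucc] at hij
        rw [hfi hij]
  · intro i
    induction i using Fin.lastCases with
    | last =>
      rw [Fin.snoc_last, Fin.snoc_castSucc, Fin.succ_last, Fin.snoc_last, hl]
      exact ⟨hb, ha⟩
    | cast i =>
      rw [Fin.snoc_castSucc, Fin.snoc_castSucc, Fin.succ_castSucc, Fin.snoc_castSucc]
      exact huf i

/-- All edges of a cycle but the first one join the two ends of the first one. -/
lemma isAcyclic_of_not_reachable_erase {E : Finset (Finset V)}
    (h : ∀ e ∈ E, ∀ a ∈ e, ∀ b ∈ e, a ≠ b → ¬ (linkGraph (E.erase e)).Reachable a b) :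
    (ofEdges E).IsAcyclic := by
  rintro l u f ⟨hl, hul, hf, hu, hfi, huf⟩
  obtain ⟨m, rfl⟩ : ∃ m, l = m + 2 := ⟨l - 2, by omega⟩
  have hex : ∀ i, ∃ g ∈ E, (g : Set V) = f i := fun i => mem_edgeSet_ofEdges.1 (hf i)
  choose g hg hgf using hex
  have hmem : ∀ i, u i.castSucc ∈ g i ∧ u i.succ ∈ g i := by
    intro i
    have := huf i
    rwa [← hgf i] at this
  have hgi : ∀ i, i ≠ 0 → g i ∈ E.erase (g 0) := by
    intro i hi
    refine mem_erase.2 ⟨fun hc => hi (hfi ?_), hg i⟩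
    rw [← hgf, ← hgf, hc]
  have hreach : ∀ i : Fin (m + 3), i ≠ 0 →
      (linkGraph (E.erase (g 0))).Reachable (u (Fin.succ 0)) (u i) := by
    intro i
    induction i using Fin.induction with
    | zero => exact fun h => absurd rfl h
    | succ i ih =>
      intro _
      by_cases hi : i = 0
      · rw [hi]
      · refine (ih ?_).trans (reachable_of_mem (hgi i hi) (hmem i).1 (hmem i).2)
        exact fun hc => hi (Fin.castSucc_eq_zero_iff.1 hc)
  have h1 := hreach (Fin.last _) (Fin.last_pos.ne')
  rw [hul] at h1
  refine h (g 0) (hg 0) _ (hmem 0).2 _ (hmem 0).1 ?_ h1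
  intro hc
  have := @hu 1 0 (by simpa using hc)
  simp at this

variable [Fintype V]

/-- Connectivity bounds the number of vertices from above. For the reverse bound, acyclicity makes
`(e, v) ↦ v` injective on the pairs with `v ∈ e` and `v ≠ p e`, with values other than the root. -/
lemma IsHypertree.of_isAcyclic {k : ℕ} (hk : 2 ≤ k) {E : Finset (Finset V)}
    (hcard : ∀ e ∈ E, e.card = k) (hE : (linkGraph E).Connected)
    (hac : (ofEdges E).IsAcyclic) : IsHypertree k E := by
  refine ⟨hcard, hE, le_antisymm ?_ ?_⟩
  · have h := card_le_of_connected hE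
    rwa [sum_congr rfl fun e he => by rw [hcard e he], sum_const, smul_eq_mul] at h
  obtain ⟨r⟩ := hE.nonempty
  obtain ⟨p, pe, hp', hpe⟩ := exists_parents hE r
  have hp : ∀ e ∈ E, p e ∈ e ∧ ∀ u ∈ e, (linkGraph E).dist r (p e) ≤ (linkGraph E).dist r u :=
    fun e he => hp' e he (by rw [← card_pos, hcard e he]; omega)
  -- The descent to the root from a vertex no higher than `p e` never uses `e`, since a parent edge
  -- has its closest vertex strictly below.
  have hroot : ∀ e ∈ E, ∀ n : ℕ, ∀ w, (linkGraph E).dist r w = n →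
      (linkGraph E).dist r w ≤ (linkGraph E).dist r (p e) →
      (linkGraph (E.erase e)).Reachable w r := by
    intro e he n
    induction n with
    | zero =>
      intro w hw _
      rw [hE.dist_eq_zero_iff.1 hw]
    | succ n ih =>
      intro w hw hle
      have hwr : w ≠ r := by
        rintro rfl
        simp at hw
      obtain ⟨h1, h2, h3⟩ := hpe w hwr
      have h4 : pe w ≠ e := by
        intro hc
        rw [hc] at h3
        omega
      exact (reachable_of_mem (mem_erase.2 ⟨h4, h1⟩) h2 (hp _ h1).1).trans
        (ih _ (by omega) (by omega))
  -- If `e` is not the parent edge of `v`, then both `v` and `p e` descend to the root without `e`,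
  -- which produces a cycle.
  have hkey : ∀ e ∈ E, ∀ v ∈ e, v ≠ p e → v ≠ r ∧ pe v = e := by
    intro e he v hv hvp
    by_contra hcon
    have h5 := dist_le_dist_add_one hE r he (hp e he).1 hv
    have h6 : (linkGraph (E.erase e)).Reachable v r := by
      by_cases hvr : v = r
      · rw [hvr]
      · obtain ⟨h1, h2, h3⟩ := hpe v hvr
        have h4 : pe v ≠ e := fun hc => hcon ⟨hvr, hc⟩
        exact (reachable_of_mem (mem_erase.2 ⟨h4, h1⟩) h2 (hp _ h1).1).trans
          (hroot e he _ _ rfl (by omega))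
    exact not_isAcyclic_of_reachable_erase he hv (hp e he).1 hvp
      (h6.trans (hroot e he _ _ rfl le_rfl).symm) hac
  have h7 : (E.sigma fun e => e.erase (p e)).card ≤ (univ.erase r).card := by
    refine card_le_card_of_injOn (fun x => x.2) ?_ ?_
    · rintro ⟨e, v⟩ hx
      simp only [coe_sigma, Set.mem_sigma_iff, mem_coe, mem_erase] at hx
      have := (hkey e hx.1 v hx.2.2 hx.2.1).1
      simpa using this
    · rintro ⟨e, v⟩ hx ⟨f, w⟩ hy hxy
      simp only [coe_sigma, Set.mem_sigma_iff, mem_coe, mem_erase] at hx hy hxy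
      obtain rfl := hxy
      have h1 := (hkey e hx.1 v hx.2.2 hx.2.1).2
      have h2 := (hkey f hy.1 v hy.2.2 hy.2.1).2
      rw [← h1, ← h2]
  rw [card_sigma_erase fun e he _ => (hp e he).1, card_erase_of_mem (mem_univ r), card_univ,
    sum_congr rfl fun e he => by rw [hcard e he], sum_const, smul_eq_mul] at h7
  have : 0 < Fintype.card V := Fintype.card_pos_iff.2 ⟨r⟩
  omega

lemma isSupertree_ofEdges {k : ℕ} (hk : 2 ≤ k) {E : Finset (Finset V)} :
    (ofEdges E).IsSupertree k ↔ IsHypertree k E := by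
  constructor
  · intro h
    have := h.nonempty
    exact .of_isAcyclic hk (isUniform_ofEdges.1 h.uniform)
      ⟨isConnected_ofEdges.1 h.connected⟩ h.acyclic
  · intro h
    exact ⟨h.connected.nonempty, rfl, isUniform_ofEdges.2 h.card_eq,
      isConnected_ofEdges.2 h.connected.preconnected,
      isAcyclic_of_not_reachable_erase fun e he a ha b hb hab =>
        h.not_reachable_erase hk he ha hb hab⟩

end OfEdges

/-! ### The spectral radius as the maximum of the energy -/

section Perron

variable {V : Type*}

/-- The form `x ↦ x^T (Q x^{k-1})` of the signless Laplacian tensor `Q` of a `k`-uniform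
hypergraph with edge set `E`. -/
def energy (k : ℕ) (E : Finset (Finset V)) (x : V → ℝ) : ℝ :=
  ∑ e ∈ E, (∑ v ∈ e, x v ^ k + k * ∏ v ∈ e, x v)

lemma energy_smul {k : ℕ} {E : Finset (Finset V)} (hE : ∀ e ∈ E, e.card = k) (c : ℝ)
    (x : V → ℝ) : energy k E (fun v => c * x v) = c ^ k * energy k E x := by
  rw [energy, energy, mul_sum]
  refine sum_congr rfl fun e he => ?_
  rw [prod_mul_distrib, prod_const, hE e he, mul_add, mul_sum]
  simp only [mul_pow]
  ring

lemma continuous_energy (k : ℕ) (E : Finset (Finset V)) : Continuous (energy k E) := by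
  unfold energy
  fun_prop

lemma energy_nonneg (k : ℕ) (E : Finset (Finset V)) {x : V → ℝ} (hx : ∀ v, 0 ≤ x v) :
    0 ≤ energy k E x := by
  refine sum_nonneg fun e _ => add_nonneg (sum_nonneg fun v _ => pow_nonneg (hx v) k)
    (mul_nonneg (Nat.cast_nonneg k) (prod_nonneg fun v _ => hx v))

lemma sum_pow_pos [Fintype V] [Nonempty V] {k : ℕ} {x : V → ℝ} (hx : ∀ v, 0 < x v) : 0 < ∑ v, x v ^ k :=
  sum_pos (fun v _ => pow_pos (hx v) k) univ_nonempty

variable [DecidableEq V]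

/-- The number of members of `E` that contain `v`. -/
def deg (E : Finset (Finset V)) (v : V) : ℕ := (E.filter fun e => v ∈ e).card

/-- The sum over the edges `e` at `v` of the product of the values of `x` on `e \ {v}`. -/
def branchSum {R : Type*} [CommSemiring R] (E : Finset (Finset V)) (x : V → R) (v : V) : R :=
  ∑ e ∈ E.filter (fun e => v ∈ e), ∏ w ∈ e.erase v, x w

lemma mul_branchSum {R : Type*} [CommSemiring R] (E : Finset (Finset V)) (x : V → R) (v : V) :
    x v * branchSum E x v = ∑ e ∈ E.filter (fun e => v ∈ e), ∏ w ∈ e, x w := by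
  rw [branchSum, mul_sum]
  refine sum_congr rfl fun e he => ?_
  rw [mul_prod_erase _ _ (mem_filter.1 he).2]

/-- As a function of one coordinate, the energy has only a term of degree `k`, a linear term and a
constant. -/
lemma energy_update (k : ℕ) (E : Finset (Finset V)) (x : V → ℝ) (v : V) :
    ∃ C : ℝ, ∀ t, energy k E (Function.update x v t) =
      deg E v * t ^ k + k * branchSum E x v * t + C := by
  refine ⟨∑ e ∈ E.filter (fun e => v ∈ e), ∑ w ∈ e.erase v, x w ^ k +
    ∑ e ∈ E.filter (fun e => v ∉ e), (∑ w ∈ e, x w ^ k + k * ∏ w ∈ e, x w), fun t => ?_⟩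
  have h1 : ∀ e ∈ E.filter (fun e => v ∈ e),
      ∑ w ∈ e, Function.update x v t w ^ k + k * ∏ w ∈ e, Function.update x v t w =
      t ^ k + (k * ∏ w ∈ e.erase v, x w) * t + ∑ w ∈ e.erase v, x w ^ k := by
    intro e he
    have hv := (mem_filter.1 he).2
    have h2 : ∀ w ∈ e.erase v, Function.update x v t w = x w := fun w hw => by
      rw [Function.update_of_ne (mem_erase.1 hw).1]
    rw [← add_sum_erase _ _ hv, ← mul_prod_erase _ _ hv, Function.update_self,
      sum_congr rfl fun w hw => by rw [h2 w hw], prod_congr rfl h2]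
    ring
  have h3 : ∀ e ∈ E.filter (fun e => v ∉ e),
      ∑ w ∈ e, Function.update x v t w ^ k + k * ∏ w ∈ e, Function.update x v t w =
      ∑ w ∈ e, x w ^ k + k * ∏ w ∈ e, x w := by
    intro e he
    have hv := (mem_filter.1 he).2
    have h2 : ∀ w ∈ e, Function.update x v t w = x w := fun w hw => by
      rw [Function.update_of_ne]
      rintro rfl
      exact hv hw
    rw [sum_congr rfl fun w hw => by rw [h2 w hw], prod_congr rfl h2]
  rw [energy, ← sum_filter_add_sum_filter_not E (fun e => v ∈ e), sum_congr rfl h1,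
    sum_congr rfl h3, sum_add_distrib, sum_add_distrib, sum_const, nsmul_eq_mul, ← sum_mul,
    ← mul_sum, deg, branchSum]
  ring

lemma coe_eq_insert_range_iff {k : ℕ} {e : Finset V} (he : e.card = k) {i : V}
    (hi : i ∈ e) (J : Fin (k - 1) → V) :
    (e : Set V) = insert i (Set.range J) ↔ univ.image J = e.erase i := by
  have hcoe : insert i (Set.range J) = ((insert i (univ.image J) : Finset V) : Set V) := by
    simp
  rw [hcoe, coe_inj]
  constructor
  · intro h
    refine (eq_of_subset_of_card_le ?_ ?_).symm
    · intro v hv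
      obtain ⟨h1, h2⟩ := mem_erase.1 hv
      rw [h] at h2
      exact (mem_insert.1 h2).resolve_left h1
    · rw [card_erase_of_mem hi, he]
      exact card_image_le.trans (by simp)
  · intro h
    rw [h, insert_erase hi]

variable [Fintype V]

lemma sum_vertex_eq_energy {k : ℕ} {E : Finset (Finset V)} (hE : ∀ e ∈ E, e.card = k)
    (x : V → ℝ) : ∑ v, (deg E v * x v ^ k + x v * branchSum E x v) = energy k E x := by
  have h1 : ∀ v, deg E v * x v ^ k + x v * branchSum E x v =
      ∑ e ∈ E, if v ∈ e then x v ^ k + ∏ w ∈ e, x w else 0 := by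
    intro v
    rw [mul_branchSum, ← sum_filter, sum_add_distrib, sum_const, nsmul_eq_mul, deg]
  rw [sum_congr rfl fun v _ => h1 v, sum_comm, energy]
  refine sum_congr rfl fun e he => ?_
  rw [← sum_filter, filter_univ_mem, sum_add_distrib, sum_const, hE e he, nsmul_eq_mul]

/-- `x` is a positive vector that maximizes the form of the signless Laplacian, with maximum
`ρ`. -/
structure IsPerronPair (k : ℕ) (E : Finset (Finset V)) (ρ : ℝ) (x : V → ℝ) : Prop where
  pos : ∀ v, 0 < x v
  eq : energy k E x = ρ * ∑ v, x v ^ k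
  le : ∀ y : V → ℝ, (∀ v, 0 ≤ y v) → energy k E y ≤ ρ * ∑ v, y v ^ k

lemma exists_maximizer [Nonempty V] {k : ℕ} (hk : k ≠ 0) {E : Finset (Finset V)}
    (hE : ∀ e ∈ E, e.card = k) : ∃ x : V → ℝ, (∀ v, 0 ≤ x v) ∧ ∑ v, x v ^ k = 1 ∧
      ∀ y : V → ℝ, (∀ v, 0 ≤ y v) → energy k E y ≤ energy k E x * ∑ v, y v ^ k := by
  set K : Set (V → ℝ) := {y | (∀ v, 0 ≤ y v) ∧ ∑ v, y v ^ k = 1} with hK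
  have hclosed : IsClosed K := by
    have h1 : IsClosed {y : V → ℝ | ∀ v, 0 ≤ y v} := by
      simp only [Set.ofPred_forall]
      exact isClosed_iInter fun v => isClosed_le continuous_const (continuous_apply v)
    have h2 : IsClosed {y : V → ℝ | ∑ v, y v ^ k = 1} :=
      isClosed_eq (by fun_prop) continuous_const
    exact h1.inter h2
  have hsub : K ⊆ Set.Icc 0 1 := by
    rintro y ⟨h1, h2⟩
    refine ⟨fun v => h1 v, fun v => ?_⟩
    have h3 : y v ^ k ≤ 1 := by
      rw [← h2]
      exact single_le_sum (f := fun v => y v ^ k) (fun w _ => pow_nonneg (h1 w) k) (mem_univ v)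
    exact (pow_le_one_iff_of_nonneg (h1 v) hk).1 h3
  have hcomp : IsCompact K := isCompact_Icc.of_isClosed_subset hclosed hsub
  have hne : K.Nonempty := by
    obtain ⟨v⟩ := ‹Nonempty V›
    refine ⟨Pi.single v 1, fun w => ?_, ?_⟩
    · by_cases h : w = v
      · subst h; simp
      · simp [h]
    · rw [sum_eq_single v]
      · simp
      · intro w _ hw
        simp [hw, hk]
      · simp
  obtain ⟨x, ⟨hx0, hx1⟩, hmax⟩ := hcomp.exists_isMaxOn hne (continuous_energy k E).continuousOn
  refine ⟨x, hx0, hx1, fun y hy => ?_⟩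
  set s := ∑ v, y v ^ k with hs
  have hs0 : 0 ≤ s := sum_nonneg fun v _ => pow_nonneg (hy v) k
  rcases hs0.eq_or_lt with h0 | hpos
  · have hy0 : ∀ v, y v = 0 := by
      intro v
      have := (sum_eq_zero_iff_of_nonneg fun v _ => pow_nonneg (hy v) k).1 h0.symm v (mem_univ v)
      exact pow_eq_zero_iff hk |>.1 this
    have h1 := energy_smul hE 0 y
    rw [zero_pow hk, zero_mul] at h1
    have h2 : (fun v => 0 * y v) = y := by ext v; simp [hy0 v]
    rw [h2] at h1
    rw [h1, ← h0, mul_zero]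
  · set c := (s ^ ((1 : ℝ) / k))⁻¹ with hc
    have hc0 : 0 < c := inv_pos.2 (Real.rpow_pos_of_pos hpos _)
    have hck : c ^ k = s⁻¹ := by
      rw [hc, inv_pow, ← Real.rpow_natCast, ← Real.rpow_mul hpos.le, one_div,
        inv_mul_cancel₀ (Nat.cast_ne_zero.2 hk), Real.rpow_one]
    have hmem : (fun v => c * y v) ∈ K := by
      refine ⟨fun v => mul_nonneg hc0.le (hy v), ?_⟩
      simp only [mul_pow]
      rw [← mul_sum, hck, inv_mul_cancel₀ hpos.ne']
    have h1 := hmax hmem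
    simp only [Set.mem_ofPred_eq] at h1
    rw [energy_smul hE, hck, inv_mul_le_iff₀ hpos] at h1
    linarith

/-- A maximizer with zeros would, by connectivity, have an edge with both a zero and a nonzero
entry. Raising all zeros to `ε` gains at least a multiple of `ε ^ (k - 1)` from that edge, while `∑
v, x v ^ k` grows only by a multiple of `ε ^ k`. For small `ε` this contradicts maximality. -/
lemma exists_isPerronPair {k : ℕ} (hk : k ≠ 0) {E : Finset (Finset V)}
    (hE : ∀ e ∈ E, e.card = k) (hconn : (linkGraph E).Connected) :
    ∃ ρ x, IsPerronPair k E ρ x := by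
  have := hconn.nonempty
  obtain ⟨x, hx0, hx1, hmax⟩ := exists_maximizer hk hE
  refine ⟨energy k E x, x, ?_, by rw [hx1, mul_one], hmax⟩
  by_contra hcon
  push Not at hcon
  obtain ⟨a, ha⟩ := hcon
  replace ha : x a = 0 := le_antisymm ha (hx0 a)
  obtain ⟨b, hb⟩ : ∃ b, x b ≠ 0 := by
    by_contra hall
    push Not at hall
    simp [hall, hk] at hx1
  obtain ⟨e, he, a, hae, ha, b, hbe, hb⟩ :
      ∃ e ∈ E, ∃ a ∈ e, x a = 0 ∧ ∃ b ∈ e, x b ≠ 0 := by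
    by_contra hno
    push Not at hno
    obtain ⟨w⟩ := hconn.preconnected a b
    have key : ∀ {u v : V}, (linkGraph E).Walk u v → x u = 0 → x v = 0 := by
      intro u v w
      induction w with
      | nil => exact id
      | cons hadj _ ih =>
        intro hu
        obtain ⟨-, f, hf, h1, h2⟩ := hadj
        exact ih (hno f hf _ h1 hu _ h2)
    exact hb (key w ha)
  set Z : Finset V := univ.filter fun v => x v = 0 with hZ
  set ρ := energy k E x with hρ
  set c := ∏ v ∈ e with x v ≠ 0, x v with hc
  have hc0 : 0 < c := prod_pos fun v hv => lt_of_le_of_ne (hx0 v) (mem_filter.1 hv).2.symm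
  have hρ0 : 0 ≤ ρ := energy_nonneg k E hx0
  have hZ0 : 0 ≤ ρ * Z.card := mul_nonneg hρ0 (Nat.cast_nonneg _)
  have hk0 : (0 : ℝ) < k := by exact_mod_cast Nat.pos_of_ne_zero hk
  have key : ∀ ε : ℝ, 0 < ε → ε ≤ 1 → k * c ≤ ρ * Z.card * ε := by
    intro ε hε hε1
    set y : V → ℝ := fun v => if x v = 0 then ε else x v with hy
    have hxy : ∀ v, x v ≤ y v := by
      intro v
      simp only [hy]
      split_ifs with h
      · rw [h]; exact hε.le
      · exact le_rfl
    have hy0 : ∀ v, 0 ≤ y v := fun v => (hx0 v).trans (hxy v)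
    have h1 : ∑ v, y v ^ k = 1 + Z.card * ε ^ k := by
      have h2 : ∀ v, y v ^ k = x v ^ k + if x v = 0 then ε ^ k else 0 := by
        intro v
        simp only [hy]
        split_ifs with h
        · simp [h, hk]
        · simp
      rw [sum_congr rfl fun v _ => h2 v, sum_add_distrib, hx1, ← sum_filter, sum_const,
        nsmul_eq_mul]
    have h3 : ∏ v ∈ e, y v = ε ^ (e.filter fun v => x v = 0).card * c := by
      rw [← prod_filter_mul_prod_filter_not e (fun v => x v = 0), hc]
      congr 1
      · rw [← prod_const]
        exact prod_congr rfl fun v hv => if_pos (mem_filter.1 hv).2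
      · exact prod_congr rfl fun v hv => if_neg (mem_filter.1 hv).2
    have h4 : (e.filter fun v => x v = 0).card ≤ k - 1 := by
      have : (e.filter fun v => x v = 0).card < e.card :=
        card_lt_card (filter_ssubset.2 ⟨b, hbe, hb⟩)
      rw [hE e he] at this
      omega
    have h5 : ρ + k * (ε ^ (k - 1) * c) ≤ energy k E y := by
      have h6 : ∀ f ∈ E, (∑ v ∈ f, x v ^ k + k * ∏ v ∈ f, x v) ≤
          ∑ v ∈ f, y v ^ k + k * ∏ v ∈ f, y v := by
        intro f _
        have h8 : ∏ v ∈ f, x v ≤ ∏ v ∈ f, y v :=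
          prod_le_prod (fun v _ => hx0 v) fun v _ => hxy v
        have h9 : ∑ v ∈ f, x v ^ k ≤ ∑ v ∈ f, y v ^ k :=
          sum_le_sum fun v _ => pow_le_pow_left₀ (hx0 v) (hxy v) k
        have := mul_le_mul_of_nonneg_left h8 hk0.le
        linarith
      have h7 : (∑ v ∈ e, x v ^ k + k * ∏ v ∈ e, x v) + k * (ε ^ (k - 1) * c) ≤
          ∑ v ∈ e, y v ^ k + k * ∏ v ∈ e, y v := by
        have h9 : ∑ v ∈ e, x v ^ k ≤ ∑ v ∈ e, y v ^ k :=
          sum_le_sum fun v _ => pow_le_pow_left₀ (hx0 v) (hxy v) k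
        rw [prod_eq_zero hae ha, h3]
        have h10 := mul_le_mul_of_nonneg_right (pow_le_pow_of_le_one hε.le hε1 h4) hc0.le
        have := mul_le_mul_of_nonneg_left h10 hk0.le
        linarith
      rw [hρ, energy, energy, ← add_sum_erase _ _ he, ← add_sum_erase _ _ he]
      have := sum_le_sum fun f (hf : f ∈ E.erase e) => h6 f (mem_of_mem_erase hf)
      linarith
    have h6 := h5.trans (hmax y hy0)
    rw [h1] at h6
    have h7 : ε ^ (k - 1) * (k * c) ≤ ε ^ (k - 1) * (ρ * Z.card * ε) := by
      have h8 : ε ^ k = ε ^ (k - 1) * ε := by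
        rw [← pow_succ, Nat.sub_add_cancel (Nat.one_le_iff_ne_zero.2 hk)]
      rw [h8] at h6
      linarith
    exact le_of_mul_le_mul_left h7 (pow_pos hε _)
  have hkc : 0 < k * c := mul_pos hk0 hc0
  -- This `ε` makes the right side of `key` at most `k * c / 2`; the added `1` avoids a division by
  -- zero.
  have h1 := key (min 1 (k * c / (2 * (ρ * Z.card + 1)))) (by positivity) (min_le_left _ _)
  have h2 : ρ * Z.card * min 1 (k * c / (2 * (ρ * Z.card + 1))) ≤
      (ρ * Z.card + 1) * (k * c / (2 * (ρ * Z.card + 1))) :=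
    mul_le_mul (by linarith) (min_le_right _ _) (by positivity) (by positivity)
  have h3 : (ρ * Z.card + 1) * (k * c / (2 * (ρ * Z.card + 1))) = k * c / 2 := by
    field_simp
  linarith

/-- With all other coordinates fixed, energy minus `ρ * ∑ v, x v ^ k` is nonpositive for `t ≥ 0` and
vanishes at the interior point `x v`, so its derivative is zero there. -/
lemma IsPerronPair.stationary {k : ℕ} (hk : k ≠ 0) {E : Finset (Finset V)} {ρ : ℝ} {x : V → ℝ}
    (h : IsPerronPair k E ρ x) (v : V) :
    deg E v * x v ^ (k - 1) + branchSum E x v = ρ * x v ^ (k - 1) := by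
  obtain ⟨C, hC⟩ := energy_update k E x v
  set g : ℝ → ℝ := fun t => deg E v * t ^ k + k * branchSum E x v * t + C -
    ρ * (t ^ k + ∑ w ∈ univ.erase v, x w ^ k) with hg
  have hsum : ∀ t, ∑ w, Function.update x v t w ^ k = t ^ k + ∑ w ∈ univ.erase v, x w ^ k := by
    intro t
    rw [← add_sum_erase _ _ (mem_univ v), Function.update_self]
    congr 1
    refine sum_congr rfl fun w hw => ?_
    rw [Function.update_of_ne (mem_erase.1 hw).1]
  have hle : ∀ t, 0 ≤ t → g t ≤ 0 := by
    intro t ht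
    have h1 := h.le (Function.update x v t) (fun w => by
      by_cases hw : w = v
      · subst hw; simpa using ht
      · rw [Function.update_of_ne hw]; exact (h.pos w).le)
    rw [hC, hsum] at h1
    simp only [hg]
    linarith
  have heq : g (x v) = 0 := by
    have h1 := h.eq
    have h2 := hC (x v)
    have h3 := hsum (x v)
    rw [Function.update_eq_self] at h2 h3
    simp only [hg]
    rw [← h2, ← h3, h1, sub_self]
  have hmax : IsLocalMax g (x v) := by
    filter_upwards [lt_mem_nhds (h.pos v)] with t ht
    rw [heq]
    exact hle t ht.le
  have hder : HasDerivAt g (deg E v * (k * x v ^ (k - 1)) + k * branchSum E x v * 1 -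
      ρ * (k * x v ^ (k - 1))) (x v) :=
    ((((hasDerivAt_pow k (x v)).const_mul _).add ((hasDerivAt_id _).const_mul _)).add_const _).sub
      (((hasDerivAt_pow k (x v)).add_const _).const_mul _)
  have h0 := hmax.hasDerivAt_eq_zero hder
  have hk0 : (k : ℝ) ≠ 0 := Nat.cast_ne_zero.2 hk
  refine mul_left_cancel₀ hk0 ?_
  linarith

lemma IsPerronPair.vertex_eq {k : ℕ} (hk : k ≠ 0) {E : Finset (Finset V)} {ρ : ℝ} {x : V → ℝ}
    (h : IsPerronPair k E ρ x) (v : V) :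
    deg E v * x v ^ k + ∑ e ∈ E.filter (fun e => v ∈ e), ∏ w ∈ e, x w = ρ * x v ^ k := by
  have h1 := h.stationary hk v
  obtain ⟨m, rfl⟩ := Nat.exists_eq_succ_of_ne_zero hk
  rw [← mul_branchSum, pow_succ]
  simp only [Nat.succ_eq_add_one, Nat.add_sub_cancel] at h1
  linear_combination x v * h1

/-! ### The signless Laplacian tensor in terms of edges -/

section Tensor

/-- These `J` are the bijective enumerations of `S`; their number cancels the factor `1 / (k - 1)!`
of the adjacency tensor. -/
lemma card_filter_image_eq (m : ℕ) {S : Finset V} (hS : S.card = m) :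
    (univ.filter fun J : Fin m → V => univ.image J = S).card = m.factorial := by
  have h : (univ.filter fun J : Fin m → V => univ.image J = S) =
      (univ : Finset (Fin m ↪ S)).image (fun f t => (f t : V)) := by
    ext J
    simp only [mem_filter, mem_univ, true_and, mem_image]
    constructor
    · intro hJ
      have hinj : Function.Injective J := by
        rw [← Set.injOn_univ, ← coe_univ, ← card_image_iff, hJ, hS, card_univ, Fintype.card_fin]
      have hmem : ∀ t, J t ∈ S := fun t => by rw [← hJ]; exact mem_image_of_mem J (mem_univ t)
      exact ⟨⟨fun t => ⟨J t, hmem t⟩, fun a b hab => hinj (congrArg Subtype.val hab)⟩, rfl⟩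
    · rintro ⟨f, rfl⟩
      refine eq_of_subset_of_card_le ?_ ?_
      · intro v hv
        obtain ⟨t, -, rfl⟩ := mem_image.1 hv
        exact (f t).2
      · rw [card_image_of_injective univ (f := fun t => (f t : V))
          (Subtype.val_injective.comp f.injective), hS, card_univ, Fintype.card_fin]
  rw [h, card_image_of_injective, card_univ, Fintype.card_embedding_eq]
  · simp [hS, Nat.descFactorial_self]
  · intro f g hfg
    ext t
    exact congrFun hfg t

open Classical in
lemma apply_adjacencyTensor {k : ℕ} {E : Finset (Finset V)}
    (hE : ∀ e ∈ E, e.card = k) (x : V → ℂ) (i : V) :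
    ∑ J : Fin (k - 1) → V, (ofEdges E).adjacencyTensor k i J * ∏ t, x (J t) =
      branchSum E x i := by
  have h1 : ∀ J : Fin (k - 1) → V, (ofEdges E).adjacencyTensor k i J * ∏ t, x (J t) =
      ∑ e ∈ E.filter (fun e => i ∈ e), if univ.image J = e.erase i then
        1 / ((k - 1).factorial : ℂ) * ∏ v ∈ e.erase i, x v else 0 := by
    intro J
    rw [adjacencyTensor]
    split_ifs with h
    · obtain ⟨e, he, heJ⟩ := mem_edgeSet_ofEdges.1 h
      have hi : i ∈ e := by
        have : i ∈ (e : Set V) := by rw [heJ]; exact Set.mem_insert _ _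
        exact this
      have himg := (coe_eq_insert_range_iff (hE e he) hi J).1 heJ
      rw [sum_eq_single e]
      · rw [if_pos himg, ← himg, prod_image]
        have : Set.InjOn J (univ : Finset (Fin (k - 1))) := by
          rw [← card_image_iff, himg, card_erase_of_mem hi, hE e he]; simp
        exact this
      · intro f hf hfe
        rw [if_neg]
        intro hc
        obtain ⟨hf1, hf2⟩ := mem_filter.1 hf
        apply hfe
        rw [← insert_erase hi, ← insert_erase hf2, ← hc, himg]
      · intro hc
        exact absurd (mem_filter.2 ⟨he, hi⟩) hc
    · rw [zero_mul, sum_eq_zero]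
      intro e he
      obtain ⟨h1, h2⟩ := mem_filter.1 he
      rw [if_neg]
      intro hc
      exact h (mem_edgeSet_ofEdges.2 ⟨e, h1, (coe_eq_insert_range_iff (hE e h1) h2 J).2 hc⟩)
  rw [sum_congr rfl fun J _ => h1 J, sum_comm, branchSum]
  refine sum_congr rfl fun e he => ?_
  obtain ⟨h1, h2⟩ := mem_filter.1 he
  rw [← sum_filter, sum_const, card_filter_image_eq _ (by rw [card_erase_of_mem h2, hE e h1]),
    nsmul_eq_mul, ← mul_assoc, mul_one_div_cancel, one_mul]
  exact_mod_cast (Nat.factorial_pos _).ne'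

lemma apply_signlessLaplacian {k : ℕ} {E : Finset (Finset V)}
    (hE : ∀ e ∈ E, e.card = k) (x : V → ℂ) (i : V) :
    Tensor.apply ((ofEdges E).signlessLaplacian k) x i =
      deg E i * x i ^ (k - 1) + branchSum E x i := by
  classical
  rw [← apply_adjacencyTensor hE, Tensor.apply]
  simp only [signlessLaplacian, add_mul, sum_add_distrib]
  congr 1
  · rw [sum_eq_single (fun _ => i)]
    · simp [degreeTensor, degree_ofEdges, deg]
    · intro J _ hJ
      rw [degreeTensor, if_neg, zero_mul]
      exact fun h => hJ (funext h)
    · simp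

end Tensor

/-- The stationarity equations make `ρ` an eigenvalue. For any eigenvector `z` the triangle
inequality turns its equations into inequalities for `|z|`; multiplied by `|z i|` and summed, they
bound `‖μ‖` by the energy quotient of `|z|`, hence by `ρ`. -/
lemma IsPerronPair.isGreatest {k : ℕ} (hk : k ≠ 0) {E : Finset (Finset V)} [Nonempty V]
    (hE : ∀ e ∈ E, e.card = k) {ρ : ℝ} {x : V → ℝ} (h : IsPerronPair k E ρ x) :
    IsGreatest (Tensor.eigenvalueModuli ((ofEdges E).signlessLaplacian k)) ρ := by
  have hρ : 0 ≤ ρ := by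
    have h1 := energy_nonneg k E fun v => (h.pos v).le
    rw [h.eq] at h1
    exact nonneg_of_mul_nonneg_left h1 (sum_pow_pos h.pos)
  constructor
  · refine ⟨ρ, ⟨fun v => x v, ?_, fun i => ?_⟩, ?_⟩
    · intro h0
      obtain ⟨v⟩ := ‹Nonempty V›
      have h1 := congrFun h0 v
      simp only [Pi.zero_apply, Complex.ofReal_eq_zero] at h1
      exact (h.pos v).ne' h1
    · rw [apply_signlessLaplacian hE]
      have h1 := congrArg (fun t : ℝ => (t : ℂ)) (h.stationary hk i)
      simp only [branchSum] at h1 ⊢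
      push_cast at h1
      exact h1
    · rw [Complex.norm_real, Real.norm_of_nonneg hρ]
  · rintro t ⟨μ, ⟨z, hz, hμ⟩, rfl⟩
    set y : V → ℝ := fun v => ‖z v‖ with hy
    have hy0 : ∀ v, 0 ≤ y v := fun v => norm_nonneg _
    have h1 : ∀ i, ‖μ‖ * y i ^ k ≤ deg E i * y i ^ k + y i * branchSum E y i := by
      intro i
      have h2 : ‖μ‖ * y i ^ (k - 1) ≤ deg E i * y i ^ (k - 1) + branchSum E y i := by
        have h3 := congrArg norm (hμ i)
        rw [apply_signlessLaplacian hE, norm_mul, norm_pow] at h3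
        rw [← h3]
        refine (norm_add_le _ _).trans (add_le_add ?_ ?_)
        · rw [norm_mul, norm_pow, Complex.norm_natCast]
        · refine (norm_sum_le _ _).trans (le_of_eq ?_)
          exact sum_congr rfl fun e _ => norm_prod _ _
      obtain ⟨m, rfl⟩ := Nat.exists_eq_succ_of_ne_zero hk
      simp only [Nat.succ_eq_add_one, Nat.add_sub_cancel] at h2 ⊢
      have := mul_le_mul_of_nonneg_left h2 (hy0 i)
      rw [pow_succ]
      linarith
    have h2 : ‖μ‖ * ∑ v, y v ^ k ≤ ρ * ∑ v, y v ^ k := by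
      refine le_trans ?_ (h.le y hy0)
      rw [← sum_vertex_eq_energy hE, mul_sum]
      exact sum_le_sum fun i _ => h1 i
    refine le_of_mul_le_mul_right h2 ?_
    obtain ⟨v, hv⟩ := Function.ne_iff.1 hz
    exact sum_pos' (fun w _ => pow_nonneg (hy0 w) k)
      ⟨v, mem_univ v, pow_pos (norm_pos_iff.2 hv) k⟩

lemma IsPerronPair.radius_eq {k : ℕ} (hk : k ≠ 0) {E : Finset (Finset V)} [Nonempty V]
    (hE : ∀ e ∈ E, e.card = k) {ρ : ℝ} {x : V → ℝ} (h : IsPerronPair k E ρ x) :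
    (ofEdges E).signlessLaplacianRadius k = ρ :=
  (h.isGreatest hk hE).csSup_eq

end Perron

/-! ### Exchange arguments in extremal trees -/

section Extremal

variable {V : Type*}

lemma exists_mem_of_reachable {E : Finset (Finset V)} {a b : V} (hab : a ≠ b)
    (h : (linkGraph E).Reachable a b) : ∃ e ∈ E, a ∈ e := by
  obtain ⟨w⟩ := h
  obtain ⟨u, hadj, -⟩ := SimpleGraph.Walk.exists_eq_cons_of_ne hab w
  obtain ⟨-, e, he, h1, -⟩ := hadj
  exact ⟨e, he, h1⟩

variable [DecidableEq V]

lemma deg_eq_sum (E : Finset (Finset V)) (v : V) : deg E v = ∑ e ∈ E, if v ∈ e then 1 else 0 := by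
  rw [deg, card_filter]

variable [Fintype V]

/-- `E` is a tree and `x` a positive vector such that no tree with the same degrees (up to their
order) has a larger energy at `x`, and such that the trees with the same energy at `x` have the
same vertex sums. -/
structure IsExtremal (k : ℕ) (E : Finset (Finset V)) (x : V → ℝ) : Prop where
  tree : IsHypertree k E
  pos : ∀ v, 0 < x v
  le : ∀ E', IsHypertree k E' → (∃ σ : Equiv.Perm V, ∀ v, deg E' (σ v) = deg E v) →
    energy k E' x ≤ energy k E x
  eq : ∀ E', IsHypertree k E' → (∃ σ : Equiv.Perm V, ∀ v, deg E' (σ v) = deg E v) →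
    energy k E' x = energy k E x → ∀ v,
      deg E' v * x v ^ k + ∑ e ∈ E'.filter (fun e => v ∈ e), ∏ w ∈ e, x w =
      deg E v * x v ^ k + ∑ e ∈ E.filter (fun e => v ∈ e), ∏ w ∈ e, x w

/-- If `E'` has the same energy at `x`, then its maximum is also `ρ` and `x` attains it. The
eigenvalue equations of `E` and `E'` at `x` then have the same right-hand sides, so the vertex sums
agree. -/
lemma IsPerronPair.isExtremal {k : ℕ} (hk : k ≠ 0) {E : Finset (Finset V)} {ρ : ℝ} {x : V → ℝ}
    (hE : IsHypertree k E) (h : IsPerronPair k E ρ x)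
    (hmax : ∀ E', IsHypertree k E' → (∃ σ : Equiv.Perm V, ∀ v, deg E' (σ v) = deg E v) →
      ∀ ρ' x', IsPerronPair k E' ρ' x' → ρ' ≤ ρ) : IsExtremal k E x := by
  have := hE.connected.nonempty
  have hpos := sum_pow_pos (k := k) h.pos
  refine ⟨hE, h.pos, fun E' hE' hσ => ?_, fun E' hE' hσ heq v => ?_⟩
  · obtain ⟨ρ', x', h'⟩ := exists_isPerronPair hk hE'.card_eq hE'.connected
    rw [h.eq]
    exact (h'.le x fun v => (h.pos v).le).trans
      (mul_le_mul_of_nonneg_right (hmax E' hE' hσ ρ' x' h') hpos.le)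
  · obtain ⟨ρ', x', h'⟩ := exists_isPerronPair hk hE'.card_eq hE'.connected
    have h1 := h'.le x fun v => (h.pos v).le
    rw [heq, h.eq] at h1
    have h2 : ρ' = ρ := le_antisymm (hmax E' hE' hσ ρ' x' h') (le_of_mul_le_mul_right h1 hpos)
    have h3 : IsPerronPair k E' ρ x := ⟨h.pos, by rw [heq, h.eq], by rw [← h2]; exact h'.le⟩
    rw [h3.vertex_eq hk, h.vertex_eq hk]

/-- This separates the part that depends only on the degrees, so that a surgery that preserves
degrees changes only the edge products. -/
lemma energy_eq (k : ℕ) (E : Finset (Finset V)) (x : V → ℝ) :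
    energy k E x = ∑ v, deg E v * x v ^ k + k * ∑ e ∈ E, ∏ w ∈ e, x w := by
  have h1 : ∀ v, (deg E v : ℝ) * x v ^ k = ∑ e ∈ E, if v ∈ e then x v ^ k else 0 := by
    intro v
    rw [← sum_filter, sum_const, nsmul_eq_mul, deg]
  rw [energy, sum_add_distrib, ← mul_sum, sum_congr rfl fun v _ => h1 v, sum_comm]
  congr 1
  refine sum_congr rfl fun e _ => ?_
  rw [← sum_filter, filter_univ_mem]

/-- Exchanging a vertex `u` of an edge `e` with a vertex `v` of an edge `f` of an extremal tree. -/
lemma IsExtremal.exchange {k : ℕ} (hk : 2 ≤ k) {E : Finset (Finset V)} {x : V → ℝ}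
    (h : IsExtremal k E x) {e f : Finset V} (he : e ∈ E) (hf : f ∈ E) (hef : e ≠ f) {u v s t : V}
    (hu : u ∈ e) (hv : v ∈ f) (huv : u ≠ v) (hs : s ∈ insert v (e.erase u))
    (ht : t ∈ insert u (f.erase v)) (hst : (linkGraph ((E.erase e).erase f)).Reachable s t) :
    (x u ≤ x v ↔ ∏ w ∈ e, x w ≤ ∏ w ∈ f, x w) ∧ (x v ≤ x u ↔ ∏ w ∈ f, x w ≤ ∏ w ∈ e, x w) := by
  set e' := insert v (e.erase u) with he'
  set f' := insert u (f.erase v) with hf'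
  set φ : Finset V → Finset V := fun g => if g = e then e' else if g = f then f' else g with hφ
  have hφe : φ e = e' := if_pos rfl
  have hφf : φ f = f' := (if_neg hef.symm).trans (if_pos rfl)
  have hφg : ∀ g ∈ (E.erase e).erase f, φ g = g := by
    intro g hg
    simp only [mem_erase] at hg
    simp only [hφ]; rw [if_neg hg.2.1, if_neg hg.1]
  have hfE : f ∈ E.erase e := mem_erase.2 ⟨hef.symm, hf⟩
  have hsub : (E.erase e).erase f ⊆ E.image φ := fun g hg =>
    mem_image.2 ⟨g, mem_of_mem_erase (mem_of_mem_erase hg), hφg g hg⟩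
  have hmem_e : e' ∈ E.image φ := mem_image.2 ⟨e, he, hφe⟩
  have hmem_f : f' ∈ E.image φ := mem_image.2 ⟨f, hf, hφf⟩
  have hst' := reachable_mono hsub hst
  -- The link from `s` to `t` avoids `e` and `f`, so it survives the exchange and holds the two new
  -- edges together.
  have hreach : ∀ z, z ∈ e' ∨ z ∈ f' → (linkGraph (E.image φ)).Reachable z s := by
    rintro z (hz | hz)
    · exact reachable_of_mem hmem_e hz hs
    · exact (reachable_of_mem hmem_f hz ht).trans hst'.symm
  have hze : ∀ z ∈ e, z ∈ e' ∨ z ∈ f' := by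
    intro z hz
    by_cases hzu : z = u
    · exact Or.inr (by rw [hzu]; exact mem_insert_self _ _)
    · exact Or.inl (mem_insert_of_mem (mem_erase.2 ⟨hzu, hz⟩))
  have hzf : ∀ z ∈ f, z ∈ e' ∨ z ∈ f' := by
    intro z hz
    by_cases hzv : z = v
    · exact Or.inl (by rw [hzv]; exact mem_insert_self _ _)
    · exact Or.inr (mem_insert_of_mem (mem_erase.2 ⟨hzv, hz⟩))
  have hconn : (linkGraph (E.image φ)).Connected := by
    refine connected_of_forall_mem h.tree.connected fun g hg a ha b hb => ?_
    by_cases hge : g = e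
    · subst hge
      exact (hreach a (hze a ha)).trans (hreach b (hze b hb)).symm
    by_cases hgf : g = f
    · subst hgf
      exact (hreach a (hzf a ha)).trans (hreach b (hzf b hb)).symm
    exact reachable_of_mem (hsub (mem_erase.2 ⟨hgf, mem_erase.2 ⟨hge, hg⟩⟩)) ha hb
  have hce : (e.erase u).card + 1 = k := by
    rw [card_erase_add_one hu, h.tree.card_eq e he]
  have hcf : (f.erase v).card + 1 = k := by
    rw [card_erase_add_one hv, h.tree.card_eq f hf]
  have hcard : ∀ g ∈ E, (φ g).card ≤ k := by
    intro g hg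
    by_cases hge : g = e
    · rw [hge, hφe, ← hce]; exact card_insert_le _ _
    by_cases hgf : g = f
    · rw [hgf, hφf, ← hcf]; exact card_insert_le _ _
    rw [hφg g (mem_erase.2 ⟨hgf, mem_erase.2 ⟨hge, hg⟩⟩), h.tree.card_eq g hg]
  obtain ⟨hinj, hck, htree⟩ := h.tree.image hk φ hcard hconn
  -- If `v` were already in `e`, the new edge would have only `k - 1` vertices, which the tree count
  -- excludes.
  have hve : v ∉ e := by
    intro hc
    have h1 := hck e he
    rw [hφe, he', insert_eq_of_mem (mem_erase.2 ⟨huv.symm, hc⟩)] at h1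
    omega
  have huf : u ∉ f := by
    intro hc
    have h1 := hck f hf
    rw [hφf, hf', insert_eq_of_mem (mem_erase.2 ⟨huv, hc⟩)] at h1
    omega
  have hsplit : ∀ {M : Type} [AddCommMonoid M] (ψ : Finset V → M),
      ∑ g ∈ E.image φ, ψ g = ψ e' + (ψ f' + ∑ g ∈ (E.erase e).erase f, ψ g) := by
    intro M _ ψ
    rw [sum_image hinj, ← add_sum_erase _ _ he, ← add_sum_erase _ _ hfE, hφe, hφf,
      sum_congr rfl fun g hg => by rw [hφg g hg]]
  have hsplit' : ∀ {M : Type} [AddCommMonoid M] (ψ : Finset V → M),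
      ∑ g ∈ E, ψ g = ψ e + (ψ f + ∑ g ∈ (E.erase e).erase f, ψ g) := by
    intro M _ ψ
    rw [← add_sum_erase _ _ he, ← add_sum_erase _ _ hfE]
  have hdeg : ∀ z, deg (E.image φ) z = deg E z := by
    intro z
    rw [deg_eq_sum, deg_eq_sum, hsplit, hsplit', ← add_assoc, ← add_assoc]
    congr 1
    simp only [he', hf', mem_insert, mem_erase]
    by_cases hzu : z = u
    · subst hzu
      simp [hu, huf, huv]
    · by_cases hzv : z = v
      · subst hzv
        simp [hv, hve, hzu]
      · simp [hzu, hzv]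
  have hσ : ∃ σ : Equiv.Perm V, ∀ z, deg (E.image φ) (σ z) = deg E z := ⟨1, hdeg⟩
  set A := ∏ w ∈ e.erase u, x w with hA
  set B := ∏ w ∈ f.erase v, x w with hB
  have hA0 : 0 < A := prod_pos fun w _ => h.pos w
  have hB0 : 0 < B := prod_pos fun w _ => h.pos w
  have hwe : ∏ w ∈ e, x w = x u * A := (mul_prod_erase _ _ hu).symm
  have hwf : ∏ w ∈ f, x w = x v * B := (mul_prod_erase _ _ hv).symm
  have hwe' : ∏ w ∈ e', x w = x v * A :=
    prod_insert fun hc => hve (mem_of_mem_erase hc)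
  have hwf' : ∏ w ∈ f', x w = x u * B :=
    prod_insert fun hc => huf (mem_of_mem_erase hc)
  have hdiff : energy k (E.image φ) x - energy k E x = k * ((x u - x v) * (B - A)) := by
    rw [energy_eq, energy_eq, hsplit, hsplit', hwe, hwf, hwe', hwf']
    simp only [hdeg]
    ring
  have hk0 : (0 : ℝ) < k := by
    have : 0 < k := by omega
    exact_mod_cast this
  have hle : (x u - x v) * (B - A) ≤ 0 := by
    have h1 := h.le _ htree hσ
    by_contra hc
    push Not at hc
    have := mul_pos hk0 hc
    linarith
  rw [hwe, hwf]
  have hxu := h.pos u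
  have hxv := h.pos v
  rcases lt_trichotomy (x u) (x v) with hlt | heq | hgt
  · have h1 : A ≤ B := by
      by_contra hc
      push Not at hc
      nlinarith [mul_pos (sub_pos.2 hlt) (sub_pos.2 hc)]
    have h2 : x u * A < x v * B := mul_lt_mul hlt h1 hA0 hxv.le
    exact ⟨⟨fun _ => h2.le, fun _ => hlt.le⟩, ⟨fun hc => absurd hc hlt.not_ge,
      fun hc => absurd hc h2.not_ge⟩⟩
  -- For `x u = x v` the energy does not change, and the inequality alone says nothing. Equality of
  -- the vertex sums at `u` gives `A = B`.
  · have h1 : energy k (E.image φ) x = energy k E x := by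
      rw [heq, sub_self, zero_mul, mul_zero] at hdiff
      linarith
    have h2 := h.eq _ htree hσ h1 u
    rw [hdeg, sum_filter, sum_filter, hsplit, hsplit', if_pos hu, if_neg huf,
      if_neg (by simp [he', huv]), if_pos (by simp [hf']), hwe, hwf'] at h2
    have h3 : x u * B = x u * A := by linarith
    have h4 : x u * A = x v * B := by rw [← h3, heq]
    rw [h4, heq]
    simp
  · have h1 : B ≤ A := by
      by_contra hc
      push Not at hc
      nlinarith [mul_pos (sub_pos.2 hgt) (sub_pos.2 hc)]
    have h2 : x v * B < x u * A := mul_lt_mul hgt h1 hB0 hxu.le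
    exact ⟨⟨fun hc => absurd hc hgt.not_ge, fun hc => absurd hc h2.not_ge⟩,
      ⟨fun _ => h2.le, fun _ => hgt.le⟩⟩

/-- Here the vertices `a` and `b` that link `e` to `f` stay in place, and two other vertices are
swapped. -/
lemma IsExtremal.compare {k : ℕ} (hk : 2 ≤ k) {E : Finset (Finset V)} {x : V → ℝ}
    (h : IsExtremal k E x) {e f : Finset V} (he : e ∈ E) (hf : f ∈ E) (hef : e ≠ f) {a b u v : V}
    (ha : a ∈ e) (hb : b ∈ f) (hab : (linkGraph ((E.erase e).erase f)).Reachable a b)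
    (hu : u ∈ e) (hv : v ∈ f) (hua : u ≠ a) (hvb : v ≠ b) :
    (x u ≤ x v ↔ ∏ w ∈ e, x w ≤ ∏ w ∈ f, x w) ∧ (x v ≤ x u ↔ ∏ w ∈ f, x w ≤ ∏ w ∈ e, x w) := by
  have huv : u ≠ v := by
    rintro rfl
    have hfE : f ∈ E.erase e := mem_erase.2 ⟨hef.symm, hf⟩
    refine h.tree.not_reachable_erase hk he ha hu hua.symm ?_
    exact (reachable_mono (erase_subset _ _) hab).trans (reachable_of_mem hfE hb hv)
  exact h.exchange hk he hf hef hu hv huv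
    (mem_insert_of_mem (mem_erase.2 ⟨hua.symm, ha⟩))
    (mem_insert_of_mem (mem_erase.2 ⟨hvb.symm, hb⟩)) hab

/-- Here the linking vertices themselves are swapped; the link then joins the new edges in the
opposite order. -/
lemma IsExtremal.compare_ends {k : ℕ} (hk : 2 ≤ k) {E : Finset (Finset V)} {x : V → ℝ}
    (h : IsExtremal k E x) {e f : Finset V} (he : e ∈ E) (hf : f ∈ E) (hef : e ≠ f) {a b : V}
    (ha : a ∈ e) (hb : b ∈ f) (hab : (linkGraph ((E.erase e).erase f)).Reachable a b)
    (hne : a ≠ b) :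
    (x a ≤ x b ↔ ∏ w ∈ e, x w ≤ ∏ w ∈ f, x w) ∧ (x b ≤ x a ↔ ∏ w ∈ f, x w ≤ ∏ w ∈ e, x w) :=
  h.exchange hk he hf hef ha hb hne (mem_insert_self _ _) (mem_insert_self _ _) hab.symm

/-- In an extremal tree the degrees are ordered like the entries of the vector. -/
lemma IsExtremal.deg_le_deg {k : ℕ} (hk : 2 ≤ k) {E : Finset (Finset V)} {x : V → ℝ}
    (h : IsExtremal k E x) {u v : V} (hx : x v ≤ x u) : deg E v ≤ deg E u := by
  by_contra hcon
  push Not at hcon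
  have huv : u ≠ v := by
    rintro rfl
    exact lt_irrefl _ hcon
  obtain ⟨p, pe, hr⟩ := h.tree.isRooting hk u
  set ht := (linkGraph E).dist u
  obtain ⟨hpv1, hpv2, hpv3⟩ := hr.edge_mem v huv.symm
  have hdu : 0 < deg E u := by
    obtain ⟨e, he, hue⟩ := exists_mem_of_reachable huv (h.tree.connected.preconnected u v)
    exact card_pos.2 ⟨e, mem_filter.2 ⟨he, hue⟩⟩
  have hT : ((E.filter fun e => v ∈ e).erase (pe v)).card = deg E v - 1 := by
    rw [card_erase_of_mem (mem_filter.2 ⟨hpv1, hpv2⟩), deg]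
  -- With the root at `u`, moving `deg E v - deg E u` edges from `v` to `u` interchanges the two
  -- degrees. The parent edge of `v` is kept; there are enough other edges since `deg E u > 0`.
  obtain ⟨S, hST, hS⟩ := exists_subset_card_eq (n := deg E v - deg E u)
    (s := (E.filter fun e => v ∈ e).erase (pe v)) (by omega)
  have hSmem : ∀ g ∈ S, g ∈ E ∧ v ∈ g ∧ g ≠ pe v := by
    intro g hg
    have := hST hg
    simp only [mem_erase, mem_filter] at this
    exact ⟨this.2.1, this.2.2, this.1⟩
  -- The edges in `S` have `v` as their closest vertex, so a descent from height at most that of `v`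
  -- does not use them.
  have hreach : ∀ n : ℕ, ∀ z, ht z = n → ht z ≤ ht v → (linkGraph (E \ S)).Reachable z u := by
    intro n
    induction n using Nat.strong_induction_on with
    | _ n ih =>
      intro z hz hzv
      by_cases hzu : z = u
      · rw [hzu]
      obtain ⟨h1, h2, h3⟩ := hr.edge_mem z hzu
      have h4 := (hr.child _ h1 z h2 h3).2.2
      have h5 : pe z ∉ S := by
        intro hc
        obtain ⟨-, h6, h7⟩ := hSmem _ hc
        by_cases h8 : v = p (pe z)
        · rw [← h8] at h4; omega
        · exact h7 (hr.child _ h1 v h6 h8).2.1.symm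
      exact (reachable_of_mem (mem_sdiff.2 ⟨h1, h5⟩) h2 (hr.parent_mem _ h1)).trans
        (ih (ht (p (pe z))) (by omega) _ rfl (by omega))
  have hvu := hreach _ v rfl le_rfl
  set φ : Finset V → Finset V := fun g => if g ∈ S then insert u (g.erase v) else g with hφ
  have hφS : ∀ g ∈ S, φ g = insert u (g.erase v) := fun g hg => if_pos hg
  have hφn : ∀ g, g ∉ S → φ g = g := fun g hg => if_neg hg
  have hsub : E \ S ⊆ E.image φ := by
    intro g hg
    obtain ⟨h1, h2⟩ := mem_sdiff.1 hg
    exact mem_image.2 ⟨g, h1, hφn g h2⟩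
  have hconn : (linkGraph (E.image φ)).Connected := by
    refine connected_of_forall_mem h.tree.connected fun g hg a ha b hb => ?_
    by_cases hgS : g ∈ S
    · have key : ∀ z ∈ g, (linkGraph (E.image φ)).Reachable z u := by
        intro z hz
        by_cases hzv : z = v
        · rw [hzv]; exact reachable_mono hsub hvu
        · refine reachable_of_mem (mem_image.2 ⟨g, hg, hφS g hgS⟩) ?_ (mem_insert_self _ _)
          exact mem_insert_of_mem (mem_erase.2 ⟨hzv, hz⟩)
      exact (key a ha).trans (key b hb).symm
    · exact reachable_of_mem (hsub (mem_sdiff.2 ⟨hg, hgS⟩)) ha hb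
  have hcS : ∀ g ∈ S, (g.erase v).card + 1 = k := fun g hg => by
    rw [card_erase_add_one (hSmem g hg).2.1, h.tree.card_eq g (hSmem g hg).1]
  have hcard : ∀ g ∈ E, (φ g).card ≤ k := by
    intro g hg
    by_cases hgS : g ∈ S
    · rw [hφS g hgS, ← hcS g hgS]; exact card_insert_le _ _
    · rw [hφn g hgS, h.tree.card_eq g hg]
  obtain ⟨hinj, hck, htree⟩ := h.tree.image hk φ hcard hconn
  have huS : ∀ g ∈ S, u ∉ g := by
    intro g hg hc
    have h1 := hck g (hSmem g hg).1
    rw [hφS g hg, insert_eq_of_mem (mem_erase.2 ⟨huv, hc⟩)] at h1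
    have := hcS g hg
    omega
  have hdeg : ∀ z, deg (E.image φ) z = (E.filter fun g => z ∈ φ g).card := by
    intro z
    rw [deg_eq_sum, sum_image hinj, card_filter]
  have hdegu : deg (E.image φ) u = deg E v := by
    have h1 : (E.filter fun g => u ∈ φ g) = (E.filter fun g => u ∈ g) ∪ S := by
      ext g
      simp only [mem_filter, mem_union]
      by_cases hgS : g ∈ S
      · simp [hφS g hgS, hgS, (hSmem g hgS).1]
      · simp [hφn g hgS, hgS]
    rw [hdeg, h1, card_union_of_disjoint, hS]
    · rw [deg] at hcon ⊢
      simp only [deg] at hcon ⊢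
      omega
    · rw [disjoint_left]
      intro g hg hgS
      exact huS g hgS (mem_filter.1 hg).2
  have hdegv : deg (E.image φ) v = deg E u := by
    have h1 : (E.filter fun g => v ∈ φ g) = (E.filter fun g => v ∈ g) \ S := by
      ext g
      simp only [mem_filter, mem_sdiff]
      by_cases hgS : g ∈ S
      · simp [hφS g hgS, hgS, huv.symm]
      · simp [hφn g hgS, hgS]
    rw [hdeg, h1, card_sdiff_of_subset, hS]
    · simp only [deg] at hcon ⊢
      omega
    · intro g hg
      exact mem_filter.2 ⟨(hSmem g hg).1, (hSmem g hg).2.1⟩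
  have hσ : ∃ σ : Equiv.Perm V, ∀ z, deg (E.image φ) (σ z) = deg E z := by
    refine ⟨Equiv.swap u v, fun z => ?_⟩
    by_cases hzu : z = u
    · rw [hzu, Equiv.swap_apply_left, hdegv]
    by_cases hzv : z = v
    · rw [hzv, Equiv.swap_apply_right, hdegu]
    rw [Equiv.swap_apply_of_ne_of_ne hzu hzv, hdeg, deg]
    congr 1
    refine filter_congr fun g _ => ?_
    by_cases hgS : g ∈ S
    · simp [hφS g hgS, hzu, hzv]
    · rw [hφn g hgS]
  have hge : energy k E x ≤ energy k (E.image φ) x := by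
    rw [energy, energy, sum_image hinj]
    refine sum_le_sum fun g _ => ?_
    by_cases hgS : g ∈ S
    · have hu' : u ∉ g.erase v := fun hc => huS g hgS (mem_of_mem_erase hc)
      have hv' := (hSmem g hgS).2.1
      rw [hφS g hgS, sum_insert hu', prod_insert hu', ← add_sum_erase _ _ hv',
        ← mul_prod_erase _ _ hv']
      have h1 : 0 ≤ ∏ w ∈ g.erase v, x w := prod_nonneg fun w _ => (h.pos w).le
      have h2 := mul_le_mul_of_nonneg_right hx h1
      have h3 := mul_le_mul_of_nonneg_left h2 (Nat.cast_nonneg (α := ℝ) k)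
      have h4 := pow_le_pow_left₀ (h.pos v).le hx k
      linarith
    · rw [hφn g hgS]
  -- The move does not lower the energy, so extremality forces equal vertex sums at `u`. But the
  -- degree term at `u` has grown strictly and the edge products there have not decreased.
  have heq := h.eq _ htree hσ (le_antisymm (h.le _ htree hσ) hge) u
  have h1 : ∑ g ∈ E.filter (fun g => u ∈ g), ∏ w ∈ g, x w ≤
      ∑ g ∈ (E.image φ).filter (fun g => u ∈ g), ∏ w ∈ g, x w := by
    rw [sum_filter, sum_filter, sum_image hinj]
    refine sum_le_sum fun g _ => ?_
    by_cases hgS : g ∈ S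
    · rw [if_neg (huS g hgS)]
      split_ifs
      · exact prod_nonneg fun w _ => (h.pos w).le
      · exact le_rfl
    · rw [hφn g hgS]
  have h2 : (deg E u : ℝ) * x u ^ k < deg (E.image φ) u * x u ^ k := by
    rw [hdegu]
    exact mul_lt_mul_of_pos_right (by exact_mod_cast hcon) (pow_pos (h.pos u) k)
  linarith

end Extremal

/-! ### From an extremal vector to a breadth-first-search ordering -/

section Ordering

variable {V : Type*}

/-- The number with the digits `c v, c (par v), …, c (par^[n - 1] v)` in base `N`, the last of
them leading. -/
def pathKey (par : V → V) (c : V → ℕ) (N : ℕ) : ℕ → V → ℕ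
  | 0, _ => 0
  | n + 1, v => pathKey par c N n (par v) * N + c v

/-- Digits below the base make the comparison of keys lexicographic, with the part of the parent
first. -/
lemma pathKey_succ_lt {par : V → V} {c : V → ℕ} {N : ℕ} (hc : ∀ v, c v < N) {n : ℕ} {u v : V}
    (h : pathKey par c N (n + 1) u < pathKey par c N (n + 1) v) :
    pathKey par c N n (par u) < pathKey par c N n (par v) ∨
      pathKey par c N n (par u) = pathKey par c N n (par v) ∧ c u < c v := by
  simp only [pathKey] at h
  rcases lt_trichotomy (pathKey par c N n (par u)) (pathKey par c N n (par v)) with h1 | h1 | h1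
  · exact Or.inl h1
  · rw [h1] at h
    exact Or.inr ⟨h1, by omega⟩
  · exfalso
    have h2 : (pathKey par c N n (par v) + 1) * N ≤ pathKey par c N n (par u) * N :=
      Nat.mul_le_mul_right N h1
    rw [add_mul, one_mul] at h2
    have := hc v
    omega

lemma pathKey_succ_inj {par : V → V} {c : V → ℕ} {N : ℕ} (hc : ∀ v, c v < N)
    (hinj : Function.Injective c) {n : ℕ} {u v : V}
    (h : pathKey par c N (n + 1) u = pathKey par c N (n + 1) v) : u = v := by
  simp only [pathKey] at h
  have h1 := congrArg (· % N) h
  simp only [Nat.mul_comm _ N, Nat.mul_add_mod,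
    Nat.mod_eq_of_lt (hc _)] at h1
  exact hinj h1

/-- The ordering of the vertices by decreasing `x`, then by height, then by the keys of the paths
to the root. -/
def pathOrder (x : V → ℝ) (ht key : V → ℕ) (u v : V) : Prop :=
  x v < x u ∨ x u = x v ∧ (ht u < ht v ∨ ht u = ht v ∧ key u < key v)

lemma pathOrder_isWellOrder [Finite V] {x : V → ℝ} {ht key : V → ℕ}
    (hkey : ∀ u v, ht u = ht v → key u = key v → u = v) :
    IsWellOrder V (pathOrder x ht key) := by
  have htrans : ∀ a b c, pathOrder x ht key a b → pathOrder x ht key b c →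
      pathOrder x ht key a c := by
    rintro a b c (h1 | ⟨h1, h2 | ⟨h2, h3⟩⟩) (g1 | ⟨g1, g2 | ⟨g2, g3⟩⟩)
    · exact Or.inl (g1.trans h1)
    · exact Or.inl (by rw [← g1]; exact h1)
    · exact Or.inl (by rw [← g1]; exact h1)
    · exact Or.inl (by rw [h1]; exact g1)
    · exact Or.inr ⟨h1.trans g1, Or.inl (h2.trans g2)⟩
    · exact Or.inr ⟨h1.trans g1, Or.inl (by omega)⟩
    · exact Or.inl (by rw [h1]; exact g1)
    · exact Or.inr ⟨h1.trans g1, Or.inl (by omega)⟩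
    · exact Or.inr ⟨h1.trans g1, Or.inr ⟨h2.trans g2, h3.trans g3⟩⟩
  have hirr : ∀ a, ¬ pathOrder x ht key a a := by
    rintro a (h | ⟨-, h | ⟨-, h⟩⟩)
    · exact lt_irrefl _ h
    · exact lt_irrefl _ h
    · exact lt_irrefl _ h
  have : IsTrans V (pathOrder x ht key) := ⟨htrans⟩
  have : Std.Irrefl (pathOrder x ht key) := ⟨hirr⟩
  refine { wf := Finite.wellFounded_of_trans_of_irrefl _, trichotomous := fun a b h1 h2 => ?_ }
  simp only [pathOrder] at h1 h2
  push Not at h1 h2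
  have hx : x a = x b := le_antisymm h1.1 h2.1
  have hh : ht a = ht b := le_antisymm (h2.2 hx.symm).1 (h1.2 hx).1
  exact hkey a b hh (le_antisymm ((h2.2 hx.symm).2 hh.symm) ((h1.2 hx).2 hh))

variable [DecidableEq V]

lemma IsRooting.height_eq_zero_iff {E : Finset (Finset V)} {r : V} {ht : V → ℕ}
    {p : Finset V → V} {pe : V → Finset V} (hr : IsRooting E r ht p pe) {v : V} :
    ht v = 0 ↔ v = r := by
  constructor
  · intro h
    by_contra hv
    obtain ⟨h1, h2, h3⟩ := hr.edge_mem v hv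
    have := (hr.child _ h1 v h2 h3).2.2
    omega
  · rintro rfl
    exact hr.height_root

/-- Follow parents from `z` until the root or an edge outside `F` is met; in the second case the
descent stops at a child `c` of that edge. -/
lemma IsRooting.reachable_or {E : Finset (Finset V)} {r : V} {ht : V → ℕ}
    {p : Finset V → V} {pe : V → Finset V} (hr : IsRooting E r ht p pe) (F : Finset (Finset V))
    (z : V) : (linkGraph F).Reachable z r ∨ ∃ g ∈ E, g ∉ F ∧ ∃ c ∈ g, c ≠ p g ∧ ht c ≤ ht z ∧
      (linkGraph F).Reachable z c := by
  induction hn : ht z using Nat.strong_induction_on generalizing z with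
  | _ n ih =>
    by_cases hz : z = r
    · exact Or.inl (by rw [hz])
    obtain ⟨h1, h2, h3⟩ := hr.edge_mem z hz
    have h4 := (hr.child _ h1 z h2 h3).2.2
    by_cases hF : pe z ∈ F
    · have h5 := reachable_of_mem hF h2 (hr.parent_mem _ h1)
      rcases ih _ (by omega) (p (pe z)) rfl with h | ⟨g, hg, hgF, c, hc, hcp, hcz, h⟩
      · exact Or.inl (h5.trans h)
      · exact Or.inr ⟨g, hg, hgF, c, hc, hcp, by omega, h5.trans h⟩
    · exact Or.inr ⟨pe z, h1, hF, z, h2, h3, hn.le, by rfl⟩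

/-- If `f` is not closer to the root than `e`, then either the closest vertices of `e` and `f` are
joined, or the closest vertex of `f` is joined to a child in `e`, without use of `e` and `f`. -/
lemma IsRooting.connect {E : Finset (Finset V)} {r : V} {ht : V → ℕ}
    {p : Finset V → V} {pe : V → Finset V} (hr : IsRooting E r ht p pe) {e f : Finset V}
    (hle : ht (p e) ≤ ht (p f)) :
    (linkGraph ((E.erase e).erase f)).Reachable (p e) (p f) ∨
      ∃ c ∈ e, c ≠ p e ∧ ht c ≤ ht (p f) ∧
        (linkGraph ((E.erase e).erase f)).Reachable c (p f) := by
  have hF : ∀ g ∈ E, g ∉ (E.erase e).erase f → g = e ∨ g = f := by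
    intro g hg hgF
    by_contra hcon
    push Not at hcon
    exact hgF (mem_erase.2 ⟨hcon.2, mem_erase.2 ⟨hcon.1, hg⟩⟩)
  have hf : ∀ z, ht z ≤ ht (p f) → (linkGraph ((E.erase e).erase f)).Reachable z r ∨
      ∃ c ∈ e, e ∈ E ∧ c ≠ p e ∧ ht c ≤ ht z ∧
        (linkGraph ((E.erase e).erase f)).Reachable z c := by
    intro z hz
    rcases hr.reachable_or ((E.erase e).erase f) z with h | ⟨g, hg, hgF, c, hc, hcp, hcz, h⟩
    · exact Or.inl h
    · rcases hF g hg hgF with rfl | rfl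
      · exact Or.inr ⟨c, hc, hg, hcp, hcz, h⟩
      · have := (hr.child _ hg c hc hcp).2.2
        omega
  rcases hf (p f) le_rfl with h1 | ⟨c, hc, he, hcp, hcz, h⟩
  · rcases hf (p e) hle with h2 | ⟨c, hc, he, hcp, hcz, h⟩
    · exact Or.inl (h2.trans h1.symm)
    · have := (hr.child _ he c hc hcp).2.2
      omega
  · exact Or.inr ⟨c, hc, hcp, hcz, h.symm⟩

variable [Fintype V]

/-- Induction on the height of `u`: exchanges between two edges carry a known inequality between
lower vertices or their descendants over to `u` and `v`. The cases are the ways in which the parent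
edges of `u` and `v` are linked. -/
lemma IsExtremal.le_of_height_lt {k : ℕ} (hk : 2 ≤ k) {E : Finset (Finset V)} {x : V → ℝ}
    (h : IsExtremal k E x) {r : V} {ht : V → ℕ} {p : Finset V → V} {pe : V → Finset V}
    (hr : IsRooting E r ht p pe) (hmax : ∀ v, x v ≤ x r) {u v : V} (huv : ht u < ht v) :
    x v ≤ x u := by
  induction hn : ht u using Nat.strong_induction_on generalizing u v with
  | _ n ih =>
    by_cases hur : u = r
    · rw [hur]; exact hmax v
    have hvr : v ≠ r := by
      rintro rfl
      rw [hr.height_root] at huv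
      omega
    obtain ⟨he, hue, hup⟩ := hr.edge_mem u hur
    obtain ⟨hf, hvf, hvp⟩ := hr.edge_mem v hvr
    set e := pe u
    set f := pe v
    have hu1 := (hr.child e he u hue hup).2.2
    have hv1 := (hr.child f hf v hvf hvp).2.2
    have hef : e ≠ f := by
      intro hc
      rw [hc] at hu1
      omega
    have hpef : p e ≠ p f := by
      intro hc
      rw [hc] at hu1
      omega
    have hpe := hr.parent_mem e he
    have hpf := hr.parent_mem f hf
    rcases hr.connect (e := e) (f := f) (by omega) with hab | ⟨c, hc, hcp, hcf, hab⟩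
    -- The parents are linked: comparing `u` with `v` is equivalent to comparing the edge products,
    -- hence to comparing the parents, where induction applies.
    · have h1 := h.compare hk he hf hef hpe hpf hab hue hvf hup hvp
      have h2 := h.compare_ends hk he hf hef hpe hpf hab hpef
      exact h1.2.2 (h2.2.1 (ih (ht (p e)) (by omega) (by omega) rfl))
    by_cases hcu : c = u
    · subst hcu
      have hfE : f ∈ E.erase e := mem_erase.2 ⟨hef.symm, hf⟩
      have hcv : (linkGraph (E.erase e)).Reachable c v :=
        (reachable_mono (erase_subset _ _) hab).trans (reachable_of_mem hfE hpf hvf)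
      -- Now `v` descends from `u`. If `v` has a child `v'` in an edge `g`, the edges `e` and `g`
      -- are linked by `u` and `v`; induction compares `p e` with `v'`, and the exchange carries
      -- this over to the ends `u` and `v`.
      by_cases hg : ∃ g ∈ E, v ∈ g ∧ p g = v
      · obtain ⟨g, hg, hvg, hgv⟩ := hg
        have heg : e ≠ g := by
          intro hc
          rw [hc, hgv] at hu1
          omega
        rcases hr.connect (e := e) (f := g) (by rw [hgv]; omega) with hab' | ⟨d, hd, hdp, -, hab'⟩
        · rw [hgv] at hab'
          exact absurd (hcv.trans (reachable_mono (erase_subset _ _) hab').symm)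
            (h.tree.not_reachable_erase hk he hue hpe hup)
        · rw [hgv] at hab'
          by_cases hdc : d = c
          · subst hdc
            obtain ⟨v', hv', hv'v⟩ := exists_mem_ne (s := g)
              (by rw [h.tree.card_eq g hg]; omega) v
            have hv'1 := (hr.child g hg v' hv' (by rw [hgv]; exact hv'v)).2.2
            rw [hgv] at hv'1
            have h1 := h.compare hk he hg heg hue hvg hab' hpe hv' hup.symm hv'v
            have h2 := h.compare_ends hk he hg heg hue hvg hab' (by rintro rfl; omega)
            exact h2.2.2 (h1.2.1 (ih (ht (p e)) (by omega) (by omega) rfl))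
          · exact absurd (hcv.trans (reachable_mono (erase_subset _ _) hab').symm)
              (h.tree.not_reachable_erase hk he hue hd (Ne.symm hdc))
      -- A vertex `v` without children has degree at most one, whereas `u` lies in its parent edge
      -- and in another edge on the way to `v`. So `x u < x v` would violate the order of the
      -- degrees.
      · push Not at hg
        by_contra hlt
        push Not at hlt
        have h1 := h.deg_le_deg hk hlt.le
        have h2 : deg E v ≤ 1 := by
          rw [deg, card_le_one_iff_subset_singleton]
          refine ⟨f, fun g hgm => ?_⟩
          obtain ⟨hgE, hvg⟩ := mem_filter.1 hgm
          rw [mem_singleton]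
          exact (hr.child g hgE v hvg (Ne.symm (hg g hgE hvg))).2.1.symm
        obtain ⟨g, hgE, hcg⟩ := exists_mem_of_reachable (by rintro rfl; omega) hcv
        obtain ⟨hge, hgE⟩ := mem_erase.1 hgE
        have h3 : 1 < deg E c :=
          one_lt_card.2 ⟨e, mem_filter.2 ⟨he, hue⟩, g, mem_filter.2 ⟨hgE, hcg⟩, hge.symm⟩
        omega
    -- The link leaves `e` at a child other than `u`, so both `u` and `p e` may be swapped with `v`;
    -- the inequality between `p e` and `v` is known by induction.
    · have h1 := h.compare hk he hf hef hc hpf hab hue hvf (Ne.symm hcu) hvp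
      have h2 := h.compare hk he hf hef hc hpf hab hpe hvf hcp.symm hvp
      exact h1.2.2 (h2.2.1 (ih (ht (p e)) (by omega) (by omega) rfl))

/-- Strict inequalities of `x` are handled by the exchange equivalences. Where these yield only
equalities, the keys decide: at equal height they compare first the parents, then the parent edges,
then the vertices. -/
theorem IsExtremal.hasBFSOrdering {k : ℕ} (hk : 2 ≤ k) {E : Finset (Finset V)} {x : V → ℝ}
    (h : IsExtremal k E x) : (ofEdges E).HasBFSOrdering := by
  have := h.tree.connected.nonempty
  obtain ⟨r, hmax⟩ := Finite.exists_max x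
  obtain ⟨p, pe, hr⟩ := h.tree.isRooting hk r
  set ht := (linkGraph E).dist r with hht
  have hdist : ∀ v, (ofEdges E).distance r v = ht v := distance_ofEdges h.tree.connected r
  have hH : ∀ {u v}, ht u < ht v → x v ≤ x u := fun huv => h.le_of_height_lt hk hr hmax huv
  set σ := Fintype.equivFin (Finset V) with hσ
  set τ := Fintype.equivFin V with hτ
  set M := Fintype.card V with hM
  -- The edge number is the leading part of the digit, so that siblings in one edge are not
  -- separated by siblings in another.
  set c : V → ℕ := fun v => σ (pe v) * M + τ v with hc
  set N := Fintype.card (Finset V) * M with hN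
  have hcN : ∀ v, c v < N := by
    intro v
    have h1 : (σ (pe v) + 1 : ℕ) * M ≤ N := Nat.mul_le_mul_right M (σ (pe v)).2
    rw [add_mul, one_mul] at h1
    have h2 := (τ v).2
    simp only [hc]
    omega
  have hc_lt : ∀ {u v}, c u < c v → σ (pe u) ≤ σ (pe v) := by
    intro u v huv
    by_contra hcon
    push Not at hcon
    have h1 : (σ (pe v) + 1 : ℕ) * M ≤ σ (pe u) * M := Nat.mul_le_mul_right M hcon
    rw [add_mul, one_mul] at h1
    have h2 := (τ v).2
    simp only [hc] at huv
    omega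
  have hcinj : Function.Injective c := by
    intro u v huv
    have h1 := congrArg (· % M) huv
    simp only [hc, Nat.mul_comm _ M, Nat.mul_add_mod, Nat.mod_eq_of_lt (τ _).2] at h1
    exact τ.injective (Fin.ext h1)
  set par : V → V := fun v => p (pe v) with hpar
  set key : V → ℕ := fun v => pathKey par c N (ht v) v with hkey
  have hkinj : ∀ u v, ht u = ht v → key u = key v → u = v := by
    intro u v huv hk
    simp only [hkey, huv] at hk
    rcases hn : ht v with _ | n
    · rw [hn] at huv
      rw [hr.height_eq_zero_iff.1 huv, hr.height_eq_zero_iff.1 hn]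
    · rw [hn] at hk
      exact pathKey_succ_inj hcN hcinj hk
  have hwo := pathOrder_isWellOrder (x := x) hkinj
  have hheight : ∀ u v, pathOrder x ht key u v → ht u ≤ ht v := by
    rintro u v (h1 | ⟨-, h1 | ⟨h1, -⟩⟩)
    · by_contra hcon
      push Not at hcon
      exact absurd (hH hcon) h1.not_ge
    · exact h1.le
    · exact h1.le
  have hxle : ∀ {u v}, pathOrder x ht key u v → x v ≤ x u := by
    rintro u v (h1 | ⟨h1, -⟩)
    · exact h1.le
    · exact h1.ge
  have hchild : ∀ e ∈ E, ∀ v ∈ e, ∀ w ∈ e, ht v = ht w + 1 → w = p e ∧ v ≠ p e := by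
    intro e he v hv w hw hvw
    by_cases h1 : w = p e
    · refine ⟨h1, ?_⟩
      rintro rfl
      rw [h1] at hvw
      omega
    · have h2 := (hr.child e he w hw h1).2.2
      by_cases h3 : v = p e
      · rw [h3] at hvw; omega
      · have := (hr.child e he v hv h3).2.2
        omega
  have hkey_lt : ∀ {u v}, u ≠ r → ht u = ht v → key u < key v →
      key (par u) < key (par v) ∨ par u = par v ∧ c u < c v := by
    intro u v hu huv hk
    have hv : v ≠ r := by
      rintro rfl
      rw [hr.height_root] at huv
      exact hu (hr.height_eq_zero_iff.1 huv)
    obtain ⟨hu1, hu2, hu3⟩ := hr.edge_mem u hu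
    obtain ⟨hv1, hv2, hv3⟩ := hr.edge_mem v hv
    have hu4 := (hr.child _ hu1 u hu2 hu3).2.2
    have hv4 := (hr.child _ hv1 v hv2 hv3).2.2
    simp only [hkey, huv] at hk
    rw [hv4] at hk
    have hpp : ht (par u) = ht (par v) := by simp only [hpar]; omega
    rcases pathKey_succ_lt hcN hk with h1 | ⟨h1, h2⟩
    · left
      simp only [hkey, hpp]
      exact h1
    · right
      refine ⟨hkinj _ _ hpp ?_, h2⟩
      simp only [hkey, hpp]
      exact h1
  refine ⟨r, pathOrder x ht key, hwo, ?_, ?_, ?_, ?_⟩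
  · intro u v huv
    rw [hdist, hdist]
    exact hheight u v huv
  · intro u v huv
    rw [degree_ofEdges, degree_ofEdges]
    exact h.deg_le_deg hk (hxle huv)
  · rintro _ ⟨e, he, rfl⟩ _ ⟨f, hf, rfl⟩ u hu u₁ hu₁ v hv v₁ hv₁ huv h1 h2
    rw [hdist, hdist] at h1 h2
    obtain ⟨rfl, hup⟩ := hchild e he u hu u₁ hu₁ h1
    obtain ⟨rfl, hvp⟩ := hchild f hf v hv v₁ hv₁ h2
    by_cases hef : e = f
    · exact Or.inl (by rw [hef])
    by_cases hpp : p e = p f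
    · exact Or.inl hpp
    right
    have hle := hheight u v huv
    rcases hr.connect (e := e) (f := f) (by omega) with hab | ⟨d, hd, hdp, hdf, -⟩
    · have h3 := h.compare hk he hf hef hu₁ hv₁ hab hu hv hup hvp
      have h4 := h.compare_ends hk he hf hef hu₁ hv₁ hab hpp
      have h5 : x (p f) ≤ x (p e) := h4.2.2 (h3.2.1 (hxle huv))
      -- If the parents have equal entries, the equivalences return `x u = x v`; then `u` precedes
      -- `v` by height or by key, and either passes to the parents.
      rcases h5.lt_or_eq with h6 | h6
      · exact Or.inl h6
      · have h7 : x u ≤ x v := h3.1.2 (h4.1.1 h6.ge)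
        refine Or.inr ⟨h6.symm, ?_⟩
        rcases huv with h8 | ⟨-, h8 | ⟨h8, h9⟩⟩
        · exact absurd h7 h8.not_ge
        · exact Or.inl (by omega)
        · refine Or.inr ⟨by omega, ?_⟩
          obtain ⟨hur, hpu, -⟩ := hr.child e he u hu hup
          have hpv := (hr.child f hf v hv hvp).2.1
          rcases hkey_lt hur h8 h9 with h10 | ⟨h10, -⟩
          · simpa only [hpar, hpu, hpv] using h10
          · simp only [hpar, hpu, hpv] at h10
            exact absurd h10 hpp
    · have h3 := (hr.child e he d hd hdp).2.2
      have h4 : ht (p e) < ht (p f) := by omega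
      rcases (hH h4).lt_or_eq with h5 | h5
      · exact Or.inl h5
      · exact Or.inr ⟨h5.symm, Or.inl h4⟩
  · rintro _ ⟨e, he, rfl⟩ a ha b hb d hd hab hbd v hbv hvd
    have hirr : ∀ z, ¬ pathOrder x ht key z z := irrefl
    have hnp : ∀ {a b}, a ∈ e → b ∈ e → pathOrder x ht key a b → b ≠ p e := by
      rintro a b ha - hab rfl
      have h1 := hheight _ _ hab
      have h2 : a ≠ p e := by
        rintro rfl
        exact hirr _ hab
      have := (hr.child e he a ha h2).2.2
      omega
    obtain ⟨hbr, hpb, hb1⟩ := hr.child e he b hb (hnp ha hb hab)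
    obtain ⟨-, hpd, hd1⟩ := hr.child e he d hd (hnp hb hd hbd)
    have h1 := hheight _ _ hbv
    have h2 := hheight _ _ hvd
    have hvr : v ≠ r := fun hc => by
      have := hr.height_eq_zero_iff.2 hc
      omega
    obtain ⟨hf, hvf, hvp⟩ := hr.edge_mem v hvr
    have hv1 := (hr.child _ hf v hvf hvp).2.2
    by_cases hef : e = pe v
    · rw [hef]; exact hvf
    exfalso
    -- Since `v` has the same height as `b` and `d`, only the link between closest vertices is
    -- possible. The exchanges give `x b = x v = x d`; then the key of `v` lies between those of two
    -- siblings, which forces the same parent and finally the same parent edge.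
    rcases hr.connect (e := e) (f := pe v) (by omega) with hcon | ⟨z, hz, hzp, hzf, -⟩
    · have hpe := hr.parent_mem e he
      have hpf := hr.parent_mem _ hf
      have h3 := h.compare hk he hf hef hpe hpf hcon hb hvf (hnp ha hb hab) hvp
      have h4 := h.compare hk he hf hef hpe hpf hcon hd hvf (hnp hb hd hbd) hvp
      have h5 : x b = x v := le_antisymm (h3.1.2 (h4.1.1 (hxle hvd))) (hxle hbv)
      have h6 : x v = x d := le_antisymm (h4.2.2 (h3.2.1 (hxle hbv))) (hxle hvd)
      have h7 : key b < key v := by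
        rcases hbv with h8 | ⟨-, h8 | ⟨-, h8⟩⟩
        · exact absurd h5 h8.ne'
        · omega
        · exact h8
      have h8 : key v < key d := by
        rcases hvd with h8 | ⟨-, h8 | ⟨-, h8⟩⟩
        · exact absurd h6 h8.ne'
        · omega
        · exact h8
      have h9 := hkey_lt hbr (by omega) h7
      have h10 := hkey_lt hvr (by omega) h8
      have h11 : par b = par d := by simp only [hpar, hpb, hpd]
      rw [h11] at h9
      rcases h9 with h9 | ⟨h9, h12⟩
      · rcases h10 with h10 | ⟨h10, -⟩
        · omega
        · rw [h10] at h9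
          exact lt_irrefl _ h9
      · rcases h10 with h10 | ⟨-, h13⟩
        · rw [h9] at h10
          exact lt_irrefl _ h10
        · have h14 := hc_lt h12
          have h15 := hc_lt h13
          rw [hpb] at h14
          rw [hpd] at h15
          exact hef (σ.injective (le_antisymm h14 h15))
    · have := (hr.child e he z hz hzp).2.2
      omega

end Ordering

/-! ### Transport along bijections of the vertices -/

section Transport

variable {V W : Type*}

lemma image_equiv_symm (G : Hypergraph V) (σ : V ≃ W) : (G.image σ).image σ.symm = G := by
  rw [image_image, Equiv.symm_comp_self]
  ext <;> simp

lemma HasPath.image {G : Hypergraph V} (σ : V ≃ W) {l : ℕ} {a b : V} (h : G.HasPath l a b) :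
    (G.image σ).HasPath l (σ a) (σ b) := by
  obtain ⟨u, e, ⟨h1, h2, h3, h4, h5⟩, rfl, rfl⟩ := h
  exact ⟨σ ∘ u, fun i => σ '' e i, ⟨fun i => Set.mem_image_of_mem σ (h1 i),
    fun i => image_mem_edgeSet_image (h2 i), σ.injective.comp h3,
    (Set.image_injective.2 σ.injective).comp h4,
    fun i => ⟨Set.mem_image_of_mem σ (h5 i).1, Set.mem_image_of_mem σ (h5 i).2⟩⟩, rfl, rfl⟩

lemma hasPath_image_iff {G : Hypergraph V} (σ : V ≃ W) {l : ℕ} {a b : V} :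
    (G.image σ).HasPath l (σ a) (σ b) ↔ G.HasPath l a b := by
  refine ⟨fun h => ?_, fun h => h.image σ⟩
  have := h.image σ.symm
  rwa [image_equiv_symm, σ.symm_apply_apply, σ.symm_apply_apply] at this

lemma distance_image (G : Hypergraph V) (σ : V ≃ W) (a b : V) :
    (G.image σ).distance (σ a) (σ b) = G.distance a b := by
  simp only [distance, hasPath_image_iff]

lemma degree_image (G : Hypergraph V) (σ : V ≃ W) (v : V) :
    (G.image σ).degree (σ v) = G.degree v := by
  have h : {e | e ∈ (G.image σ).edgeSet ∧ σ v ∈ e} =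
      Set.image σ '' {e | e ∈ G.edgeSet ∧ v ∈ e} := by
    ext s
    constructor
    · rintro ⟨⟨e, he, rfl⟩, hv⟩
      exact ⟨e, ⟨he, (σ.injective.mem_set_image).1 hv⟩, rfl⟩
    · rintro ⟨e, ⟨he, hv⟩, rfl⟩
      exact ⟨⟨e, he, rfl⟩, Set.mem_image_of_mem σ hv⟩
  rw [degree, degree, h, Set.ncard_image_of_injective _ (Set.image_injective.2 σ.injective)]

lemma IsCycle.image {G : Hypergraph V} (σ : V ≃ W) {l : ℕ} {u : Fin (l + 1) → V}
    {e : Fin l → Set V} (h : G.IsCycle u e) : (G.image σ).IsCycle (σ ∘ u) (fun i => σ '' e i) := by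
  obtain ⟨h1, h2, h3, h4, h5, h6⟩ := h
  exact ⟨h1, congrArg σ h2, fun i => image_mem_edgeSet_image (h3 i), σ.injective.comp h4,
    (Set.image_injective.2 σ.injective).comp h5,
    fun i => ⟨Set.mem_image_of_mem σ (h6 i).1, Set.mem_image_of_mem σ (h6 i).2⟩⟩

lemma IsSupertree.image {G : Hypergraph V} {k : ℕ} (h : G.IsSupertree k) (σ : V ≃ W) :
    (G.image σ).IsSupertree k := by
  obtain ⟨h1, h2, h3, h4, h5⟩ := h
  refine ⟨h1.map σ, ?_, ?_, ?_, ?_⟩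
  · rw [image_vertexSet, h2, Set.image_univ, σ.surjective.range_eq]
  · rintro _ ⟨e, he, rfl⟩
    rw [Set.ncard_image_of_injective _ σ.injective, h3 e he]
  · rintro _ ⟨a, ha, rfl⟩ _ ⟨b, hb, rfl⟩
    obtain ⟨l, hl⟩ := h4 a ha b hb
    exact ⟨l, hl.image σ⟩
  · intro l u e hc
    have := hc.image σ.symm
    rw [image_equiv_symm] at this
    exact h5 _ _ _ this

lemma IsBFSOrdering.image {G : Hypergraph V} {root : V} {r : V → V → Prop}
    (h : G.IsBFSOrdering root r) (σ : V ≃ W) {s : W → W → Prop}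
    (hs : ∀ a b, s (σ a) (σ b) ↔ r a b) : (G.image σ).IsBFSOrdering (σ root) s := by
  have hs' : s = fun a b => r (σ.symm a) (σ.symm b) := by
    ext a b
    rw [← hs, σ.apply_symm_apply, σ.apply_symm_apply]
  refine ⟨?_, ?_, ?_, ?_, ?_⟩
  · have := h.wellOrder
    rw [hs']
    exact (RelIso.preimage σ.symm r).toRelEmbedding.isWellOrder
  · intro u v
    obtain ⟨u, rfl⟩ := σ.surjective u
    obtain ⟨v, rfl⟩ := σ.surjective v
    rw [hs, distance_image, distance_image]
    exact h.height u v
  · intro u v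
    obtain ⟨u, rfl⟩ := σ.surjective u
    obtain ⟨v, rfl⟩ := σ.surjective v
    rw [hs, degree_image, degree_image]
    exact h.degree u v
  · rintro _ ⟨e, he, rfl⟩ _ ⟨f, hf, rfl⟩ _ ⟨u, hu, rfl⟩ _ ⟨u₁, hu₁, rfl⟩ _ ⟨v, hv, rfl⟩
      _ ⟨v₁, hv₁, rfl⟩
    simp only [hs, distance_image, σ.injective.eq_iff]
    exact h.parent e he f hf u hu u₁ hu₁ v hv v₁ hv₁
  · rintro _ ⟨e, he, rfl⟩ _ ⟨a, ha, rfl⟩ _ ⟨b, hb, rfl⟩ _ ⟨c, hc, rfl⟩ hab hbc v hbv hvc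
    obtain ⟨v, rfl⟩ := σ.surjective v
    rw [hs] at hab hbc hbv hvc
    exact Set.mem_image_of_mem σ (h.consecutive e he a ha b hb c hc hab hbc v hbv hvc)

lemma exists_equiv_fin_of_isWellOrder {n : ℕ} [Fintype V] (hV : Fintype.card V = n)
    (r : V → V → Prop) [IsWellOrder V r] : ∃ σ : V ≃ Fin n, ∀ a b, σ a < σ b ↔ r a b := by
  classical
  let := linearOrderOfSTO r
  let φ := (Fintype.orderIsoFinOfCardEq V hV).symm
  exact ⟨φ.toEquiv, fun a b => φ.lt_iff_lt⟩

end Transport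

/-! ### A breadth-first-search numbering is determined by the degrees -/

section Numbering

variable {k n : ℕ} {E E' : Finset (Finset (Fin n))} {root root' : Fin n}

/-- The consequences of a breadth-first-search ordering for the numbering of the vertices by it. -/
structure IsBFSNumbering (k : ℕ) (E : Finset (Finset (Fin n))) (root : Fin n)
    (p : Finset (Fin n) → Fin n) (pe : Fin n → Finset (Fin n)) : Prop where
  root_val : (root : ℕ) = 0
  parent_mem : ∀ e ∈ E, p e ∈ e
  child : ∀ e ∈ E, ∀ v ∈ e, v ≠ p e → v ≠ root ∧ pe v = e
  edge_mem : ∀ v, v ≠ root → pe v ∈ E ∧ v ∈ pe v ∧ p (pe v) < v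
  mono : ∀ u v, u ≠ root → v ≠ root → u < v → p (pe u) ≤ p (pe v)
  convex : ∀ u v w, u ≠ root → w ≠ root → u ≤ v → v ≤ w → pe u = pe w → pe v = pe u
  card_eq : ∀ e ∈ E, e.card = k

lemma IsBFSOrdering.isBFSNumbering (hk : 2 ≤ k) (hE : IsHypertree k E)
    (h : (ofEdges E).IsBFSOrdering root (· < ·)) : ∃ p pe, IsBFSNumbering k E root p pe := by
  obtain ⟨p, pe, hr⟩ := hE.isRooting hk root
  set ht := (linkGraph E).dist root with hht
  have hdist : ∀ v, (ofEdges E).distance root v = ht v := distance_ofEdges hE.connected root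
  have hheight : ∀ u v, u < v → ht u ≤ ht v := by
    intro u v huv
    rw [← hdist, ← hdist]
    exact h.height u v huv
  have hedge : ∀ v, v ≠ root → pe v ∈ E ∧ v ∈ pe v ∧ v ≠ p (pe v) ∧ ht v = ht (p (pe v)) + 1 := by
    intro v hv
    obtain ⟨h1, h2, h3⟩ := hr.edge_mem v hv
    exact ⟨h1, h2, h3, (hr.child _ h1 v h2 h3).2.2⟩
  have hlt : ∀ v, v ≠ root → p (pe v) < v := by
    intro v hv
    obtain ⟨h1, h2, h3, h4⟩ := hedge v hv
    rcases lt_trichotomy (p (pe v)) v with h5 | h5 | h5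
    · exact h5
    · exact absurd h5.symm h3
    · have := hheight _ _ h5
      omega
  have hroot : ∀ v, root ≤ v := by
    intro v
    by_contra hcon
    push Not at hcon
    have h1 := hheight _ _ hcon
    rw [hr.height_root, Nat.le_zero, hr.height_eq_zero_iff] at h1
    exact hcon.ne h1
  refine ⟨p, pe, ?_, hr.parent_mem, fun e he v hv hvp =>
    ⟨(hr.child e he v hv hvp).1, (hr.child e he v hv hvp).2.1⟩,
    fun v hv => ⟨(hedge v hv).1, (hedge v hv).2.1, hlt v hv⟩, ?_, ?_, hE.card_eq⟩
  · have hn : 0 < n := root.pos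
    exact Nat.le_zero.1 (hroot ⟨0, hn⟩)
  · intro u v hu hv huv
    obtain ⟨hu1, hu2, -, hu4⟩ := hedge u hu
    obtain ⟨hv1, hv2, -, hv4⟩ := hedge v hv
    rcases h.parent _ (coe_mem_edgeSet_ofEdges.2 hu1) _ (coe_mem_edgeSet_ofEdges.2 hv1) u hu2
      (p (pe u)) (hr.parent_mem _ hu1) v hv2 (p (pe v)) (hr.parent_mem _ hv1) huv
      (by rw [hdist, hdist, hu4]) (by rw [hdist, hdist, hv4]) with h1 | h1
    · exact h1.le
    · exact h1.le
  · intro u v w hu hw huv hvw huw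
    rcases huv.eq_or_lt with rfl | huv
    · rfl
    rcases hvw.eq_or_lt with rfl | hvw
    · exact huw.symm
    obtain ⟨hu1, hu2, hu3, hu4⟩ := hedge u hu
    obtain ⟨hw1, hw2, hw3, hw4⟩ := hedge w hw
    have h1 := h.consecutive _ (coe_mem_edgeSet_ofEdges.2 hu1) _ (hr.parent_mem _ hu1) u hu2 w
      (by rw [huw]; exact hw2) (hlt u hu) (huv.trans hvw) v huv hvw
    exact (hr.child _ hu1 v h1 ((hlt u hu).trans huv).ne').2.1

namespace IsBFSNumbering

variable {p p' : Finset (Fin n) → Fin n} {pe pe' : Fin n → Finset (Fin n)}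

lemma filter_eq_erase (h : IsBFSNumbering k E root p pe) {e : Finset (Fin n)} (he : e ∈ E) :
    (univ.filter fun v => v ≠ root ∧ pe v = e) = e.erase (p e) := by
  ext v
  simp only [mem_filter, mem_univ, true_and, mem_erase]
  constructor
  · rintro ⟨hv, rfl⟩
    obtain ⟨-, h2, h3⟩ := h.edge_mem v hv
    exact ⟨h3.ne', h2⟩
  · rintro ⟨h1, h2⟩
    exact h.child e he v h2 h1

lemma card_children (h : IsBFSNumbering k E root p pe) {A : Finset (Finset (Fin n))}
    (hA : A ⊆ E) : (univ.filter fun v => v ≠ root ∧ pe v ∈ A).card = A.card * (k - 1) := by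
  rw [card_eq_sum_card_fiberwise (f := pe) (t := A) (fun v hv => by
    simpa using (mem_filter.1 hv).2.2), sum_const_nat]
  intro e he
  rw [← h.card_eq e (hA he), ← card_erase_of_mem (h.parent_mem e (hA he)),
    ← h.filter_eq_erase (hA he)]
  congr 1
  ext v
  simp only [mem_filter, mem_univ, true_and]
  constructor
  · rintro ⟨⟨h1, -⟩, h2⟩
    exact ⟨h1, h2⟩
  · rintro ⟨h1, h2⟩
    exact ⟨⟨h1, h2 ▸ he⟩, h2⟩

/-- The vertex `i` is the closest vertex of every edge at `i` except its own parent edge, which the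
root lacks; each such edge has `k - 1` children. -/
lemma card_parent_eq (h : IsBFSNumbering k E root p pe) (i : Fin n) :
    (univ.filter fun v => v ≠ root ∧ p (pe v) = i).card =
      (deg E i - if i = root then 0 else 1) * (k - 1) := by
  have h1 : (univ.filter fun v => v ≠ root ∧ p (pe v) = i) =
      univ.filter fun v => v ≠ root ∧ pe v ∈ E.filter fun e => p e = i := by
    ext v
    simp only [mem_filter, mem_univ, true_and]
    exact ⟨fun hv => ⟨hv.1, (h.edge_mem v hv.1).1, hv.2⟩, fun hv => ⟨hv.1, hv.2.2⟩⟩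
  rw [h1, h.card_children (filter_subset _ _)]
  congr 1
  by_cases hi : i = root
  · rw [if_pos hi, Nat.sub_zero, deg]
    congr 1
    refine filter_congr fun e he => ⟨?_, fun hie => ?_⟩
    · rintro rfl
      exact h.parent_mem e he
    · by_contra hne
      exact (h.child e he i hie (Ne.symm hne)).1 hi
  · obtain ⟨h2, h3, h4⟩ := h.edge_mem i hi
    rw [if_neg hi, deg, ← card_erase_of_mem (mem_filter.2 ⟨h2, h3⟩)]
    congr 1
    ext e
    simp only [mem_filter, mem_erase]
    constructor
    · rintro ⟨he, rfl⟩
      refine ⟨?_, he, h.parent_mem e he⟩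
      intro hee
      rw [← hee] at h4
      exact lt_irrefl _ h4
    · rintro ⟨hne, he, hie⟩
      refine ⟨he, ?_⟩
      by_contra hpi
      exact hne (h.child e he i hie (Ne.symm hpi)).2.symm

/-- Both parent functions are monotone on the non-root vertices and have fibres of equal sizes,
which determines such a function. -/
lemma parent_eq (h : IsBFSNumbering k E root p pe) (h' : IsBFSNumbering k E' root p' pe')
    (hdeg : ∀ v, deg E v = deg E' v) {v : Fin n} (hv : v ≠ root) : p (pe v) = p' (pe' v) := by
  have hcard : ∀ i, (univ.filter fun v => v ≠ root ∧ p (pe v) ≤ i).card =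
      (univ.filter fun v => v ≠ root ∧ p' (pe' v) ≤ i).card := by
    intro i
    rw [card_eq_sum_card_fiberwise (f := fun v => p (pe v)) (t := Iic i)
        (fun v hv => by simpa using (mem_filter.1 hv).2.2),
      card_eq_sum_card_fiberwise (f := fun v => p' (pe' v)) (t := Iic i)
        (fun v hv => by simpa using (mem_filter.1 hv).2.2)]
    refine sum_congr rfl fun j hj => ?_
    have hj' := mem_Iic.1 hj
    have h1 : ((univ.filter fun v => v ≠ root ∧ p (pe v) ≤ i).filter fun v => p (pe v) = j) =
        univ.filter fun v => v ≠ root ∧ p (pe v) = j := by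
      ext v
      simp only [mem_filter, mem_univ, true_and]
      exact ⟨fun hv => ⟨hv.1.1, hv.2⟩, fun hv => ⟨⟨hv.1, hv.2 ▸ hj'⟩, hv.2⟩⟩
    have h2 : ((univ.filter fun v => v ≠ root ∧ p' (pe' v) ≤ i).filter fun v => p' (pe' v) = j) =
        univ.filter fun v => v ≠ root ∧ p' (pe' v) = j := by
      ext v
      simp only [mem_filter, mem_univ, true_and]
      exact ⟨fun hv => ⟨hv.1.1, hv.2⟩, fun hv => ⟨⟨hv.1, hv.2 ▸ hj'⟩, hv.2⟩⟩
    rw [h1, h2, h.card_parent_eq, h'.card_parent_eq, hdeg]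
  have key : ∀ (f g : Fin n → Fin n), (∀ u v, u ≠ root → v ≠ root → u < v → f u ≤ f v) →
      (∀ u v, u ≠ root → v ≠ root → u < v → g u ≤ g v) →
      (∀ i, (univ.filter fun v => v ≠ root ∧ f v ≤ i).card =
        (univ.filter fun v => v ≠ root ∧ g v ≤ i).card) → g v ≤ f v := by
    intro f g hf hg hfg
    by_contra hlt
    push Not at hlt
    -- If `f v < g v`, monotonicity puts the sublevel set of `g` at `f v` inside that of `f`, and
    -- `v` lies only in the latter.
    refine (card_lt_card ?_).ne' (hfg (f v))
    refine ⟨fun w hw => ?_, fun hsub => ?_⟩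
    · simp only [mem_filter, mem_univ, true_and] at hw ⊢
      refine ⟨hw.1, ?_⟩
      rcases lt_trichotomy w v with h1 | rfl | h1
      · exact hf w v hw.1 hv h1
      · exact le_rfl
      · exact absurd ((hg v w hv hw.1 h1).trans hw.2) hlt.not_ge
    · have h1 := hsub (show v ∈ univ.filter fun w => w ≠ root ∧ f w ≤ f v by simp [hv])
      simp only [mem_filter, mem_univ, true_and] at h1
      exact hlt.not_ge h1.2
  exact le_antisymm
    (key _ _ h'.mono h.mono fun i => (hcard i).symm)
    (key _ _ h.mono h'.mono hcard)

/-- Non-root vertices are numbered from `1`. Those before the first child `b` of an edge fill whole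
edges by convexity, so `b - 1` is a multiple of `k - 1` and the children of the edge form one block
of length `k - 1`. -/
lemma erase_eq_block (hk : 2 ≤ k) (h : IsBFSNumbering k E root p pe) {v : Fin n}
    (hv : v ≠ root) : (pe v).erase (p (pe v)) =
      univ.filter fun w : Fin n => w ≠ root ∧ ((w : ℕ) - 1) / (k - 1) = ((v : ℕ) - 1) / (k - 1) := by
  have hpos : ∀ w : Fin n, w ≠ root → 1 ≤ (w : ℕ) := by
    intro w hw
    by_contra hcon
    apply hw
    ext
    rw [h.root_val]
    omega
  obtain ⟨hE, hve, -⟩ := h.edge_mem v hv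
  set B := univ.filter fun w => w ≠ root ∧ pe w = pe v with hB
  have hBe : B = (pe v).erase (p (pe v)) := h.filter_eq_erase hE
  have hBcard : B.card = k - 1 := by
    rw [hBe, card_erase_of_mem (h.parent_mem _ hE), h.card_eq _ hE]
  have hvB : v ∈ B := by simp [hB, hv]
  obtain ⟨b, hb, hbmin⟩ := B.exists_min_image id ⟨v, hvB⟩
  simp only [id] at hbmin
  obtain ⟨hbr, hbv⟩ : b ≠ root ∧ pe b = pe v := by simpa [hB] using hb
  have hmemB : ∀ w, w ∈ B ↔ w ≠ root ∧ pe w = pe v := by simp [hB]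
  have hcount : (univ.filter fun w => w ≠ root ∧ w < b).card = (b : ℕ) - 1 := by
    have h1 : (univ.filter fun w => w ≠ root ∧ w < b) = (Iio b).erase root := by
      ext w
      simp
    rw [h1, card_erase_of_mem, Fin.card_Iio]
    rw [mem_Iio, Fin.lt_def, h.root_val]
    exact hpos b hbr
  have hclosed : (univ.filter fun w => w ≠ root ∧ w < b) = univ.filter fun w => w ≠ root ∧
      pe w ∈ (univ.filter fun w => w ≠ root ∧ w < b).image pe := by
    ext w
    simp only [mem_filter, mem_univ, true_and, mem_image]
    constructor
    · exact fun hw => ⟨hw.1, w, hw, rfl⟩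
    · rintro ⟨hw, z, ⟨hz, hzb⟩, hzw⟩
      refine ⟨hw, ?_⟩
      by_contra hbw
      push Not at hbw
      have h1 := h.convex z b w hz hw hzb.le hbw hzw
      exact (hbmin z ((hmemB z).2 ⟨hz, by rw [← h1, hbv]⟩)).not_gt hzb
  have hdiv : ∃ t, (b : ℕ) - 1 = t * (k - 1) := by
    rw [← hcount, hclosed]
    refine ⟨_, h.card_children fun e he => ?_⟩
    obtain ⟨w, hw, rfl⟩ := mem_image.1 he
    exact (h.edge_mem w (mem_filter.1 hw).2.1).1
  obtain ⟨t, ht⟩ := hdiv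
  have hquot : ∀ w ∈ B, ((w : ℕ) - 1) / (k - 1) = t := by
    intro w hw
    obtain ⟨hwr, hwv⟩ := (hmemB w).1 hw
    have hbw := hbmin w hw
    have h1 : Icc b w ⊆ B := by
      intro z hz
      obtain ⟨h2, h3⟩ := mem_Icc.1 hz
      refine (hmemB z).2 ⟨?_, ?_⟩
      · rintro rfl
        have h4 : (b : ℕ) ≤ z := h2
        rw [h.root_val] at h4
        have := hpos b hbr
        omega
      · rw [h.convex b z w hbr hwr h2 h3 (by rw [hbv, hwv]), hbv]
    have h2 := card_le_card h1
    rw [Fin.card_Icc, hBcard] at h2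
    have h3 : (b : ℕ) ≤ w := hbw
    have h4 := hpos b hbr
    rw [Nat.div_eq_iff (by omega)]
    constructor <;> omega
  rw [← hBe]
  refine eq_of_subset_of_card_le ?_ ?_
  · intro w hw
    simp only [mem_filter, mem_univ, true_and]
    exact ⟨((hmemB w).1 hw).1, by rw [hquot w hw, hquot v hvB]⟩
  · rw [hBcard, hquot v hvB]
    have h1 : (univ.filter fun w : Fin n => w ≠ root ∧ ((w : ℕ) - 1) / (k - 1) = t).card ≤
        (Ico (t * (k - 1) + 1) (t * (k - 1) + 1 + (k - 1))).card := by
      refine card_le_card_of_injOn (fun w => (w : ℕ)) ?_ (Fin.val_injective.injOn)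
      intro w hw
      simp only [coe_filter, mem_univ, true_and, Set.mem_ofPred_eq] at hw
      obtain ⟨h1, h2⟩ := hw
      rw [Nat.div_eq_iff (by omega)] at h2
      have := hpos w h1
      simp only [coe_Ico, Set.mem_Ico]
      constructor <;> omega
    rwa [Nat.card_Ico, Nat.add_sub_cancel_left] at h1

lemma eq_image (hk : 2 ≤ k) (h : IsBFSNumbering k E root p pe) :
    E = (univ.filter fun v => v ≠ root).image pe := by
  ext e
  simp only [mem_image, mem_filter, mem_univ, true_and]
  constructor
  · intro he
    obtain ⟨v, hv, hvp⟩ := exists_mem_ne (s := e) (by rw [h.card_eq e he]; omega) (p e)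
    obtain ⟨h1, h2⟩ := h.child e he v hv hvp
    exact ⟨v, h1, h2⟩
  · rintro ⟨v, hv, rfl⟩
    exact (h.edge_mem v hv).1

lemma eq_of_deg_eq (hk : 2 ≤ k) (h : IsBFSNumbering k E root p pe)
    (h' : IsBFSNumbering k E' root p' pe') (hdeg : ∀ v, deg E v = deg E' v) : E = E' := by
  rw [h.eq_image hk, h'.eq_image hk]
  refine image_congr fun v hv => ?_
  have hv' : v ≠ root := by simpa using hv
  rw [← insert_erase (h.parent_mem _ (h.edge_mem v hv').1),
    ← insert_erase (h'.parent_mem _ (h'.edge_mem v hv').1), h.erase_eq_block hk hv',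
    h'.erase_eq_block hk hv', h.parent_eq h' hdeg hv']

end IsBFSNumbering

/-- Both degree functions are antitone in the numbering and are rearrangements of each other, hence
equal; parents and sibling blocks then agree. -/
lemma eq_of_isBFSOrdering_lt (hk : 2 ≤ k) (hE : IsHypertree k E) (hE' : IsHypertree k E')
    (h : (ofEdges E).IsBFSOrdering root (· < ·)) (h' : (ofEdges E').IsBFSOrdering root' (· < ·))
    (hσ : ∃ σ : Equiv.Perm (Fin n), ∀ v, deg E' (σ v) = deg E v) : E = E' := by
  obtain ⟨p, pe, hp⟩ := h.isBFSNumbering hk hE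
  obtain ⟨p', pe', hp'⟩ := h'.isBFSNumbering hk hE'
  obtain rfl : root = root' := Fin.ext (hp.root_val.trans hp'.root_val.symm)
  refine hp.eq_of_deg_eq hk hp' ?_
  obtain ⟨σ, hσ⟩ := hσ
  have hanti : ∀ {F : Finset (Finset (Fin n))} {r : Fin n},
      (ofEdges F).IsBFSOrdering r (· < ·) → Antitone (deg F) := by
    intro F r hF u v huv
    rcases huv.eq_or_lt with rfl | huv
    · exact le_rfl
    · have := hF.degree u v huv
      rwa [degree_ofEdges, degree_ofEdges] at this
  have h1 : Monotone ((OrderDual.toDual ∘ deg E') ∘ σ) := by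
    intro u v huv
    simp only [Function.comp_apply, hσ]
    exact hanti h huv
  have h2 : Monotone ((OrderDual.toDual ∘ deg E') ∘ (1 : Equiv.Perm (Fin n))) := by
    intro u v huv
    exact hanti h' huv
  have h3 := Tuple.unique_monotone h1 h2
  intro v
  have h4 := congrFun h3 v
  simp only [Function.comp_apply, hσ] at h4
  exact h4

end Numbering

/-! ### Isomorphism invariance of the spectral radius -/

section Invariance

variable {V W : Type*}

lemma signlessLaplacian_image (G : Hypergraph V) (σ : V ≃ W) (k : ℕ) (i : V)
    (J : Fin (k - 1) → V) :
    (G.image σ).signlessLaplacian k (σ i) (fun t => σ (J t)) = G.signlessLaplacian k i J := by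
  have h1 : insert (σ i) (Set.range fun t => σ (J t)) = σ '' insert i (Set.range J) := by
    rw [Set.image_insert_eq, ← Set.range_comp]
    rfl
  have h2 : σ '' insert i (Set.range J) ∈ (G.image σ).edgeSet ↔
      insert i (Set.range J) ∈ G.edgeSet := by
    rw [image_edgeSet, (Set.image_injective.2 σ.injective).mem_set_image]
  rw [signlessLaplacian, signlessLaplacian, degreeTensor, degreeTensor, adjacencyTensor,
    adjacencyTensor, degree_image]
  have h3 : (∀ t, σ (J t) = σ i) ↔ ∀ t, J t = i := by simp only [σ.injective.eq_iff]
  rw [← h1] at h2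
  congr 1
  · by_cases h : ∀ t, J t = i
    · rw [if_pos h, if_pos (h3.2 h)]
    · rw [if_neg h, if_neg fun hc => h (h3.1 hc)]
  · by_cases h : insert i (Set.range J) ∈ G.edgeSet
    · rw [if_pos h, if_pos (h2.2 h)]
    · rw [if_neg h, if_neg fun hc => h (h2.1 hc)]

variable [Fintype V] [Fintype W]

lemma eigenvalueModuli_image_le (G : Hypergraph V) (σ : V ≃ W) (k : ℕ) :
    Tensor.eigenvalueModuli (G.signlessLaplacian k) ⊆
      Tensor.eigenvalueModuli ((G.image σ).signlessLaplacian k) := by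
  rintro t ⟨μ, ⟨x, hx, hμ⟩, rfl⟩
  refine ⟨μ, ⟨fun w => x (σ.symm w), fun h0 => hx ?_, fun i => ?_⟩, rfl⟩
  · ext v
    simpa using congrFun h0 (σ v)
  · obtain ⟨i, rfl⟩ := σ.surjective i
    simp only [σ.symm_apply_apply]
    rw [← hμ i, Tensor.apply, Tensor.apply]
    refine (Fintype.sum_equiv (Equiv.arrowCongr (Equiv.refl (Fin (k - 1))) σ) _ _ fun J => ?_).symm
    change _ = (G.image σ).signlessLaplacian k (σ i) (fun t => σ (J t)) *
      ∏ t, x (σ.symm (σ (J t)))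
    simp only [signlessLaplacian_image, σ.symm_apply_apply]

lemma Isomorphic.radius_eq {G : Hypergraph V} {H : Hypergraph W} (h : G.Isomorphic H) (k : ℕ) :
    G.signlessLaplacianRadius k = H.signlessLaplacianRadius k := by
  obtain ⟨σ, rfl⟩ := h
  rw [signlessLaplacianRadius, signlessLaplacianRadius, Tensor.spectralRadius,
    Tensor.spectralRadius]
  congr 1
  refine (eigenvalueModuli_image_le G σ k).antisymm ?_
  have := eigenvalueModuli_image_le (G.image σ) σ.symm k
  rwa [image_equiv_symm] at this

end Invariance

/-! ### Maximizers and breadth-first-search supertrees with given degrees -/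

section Supertrees

variable {k n : ℕ} {d : Fin n → ℕ}

lemma exists_isHypertree_of_isSupertree {V : Type*} [Fintype V] [DecidableEq V] (hk : 2 ≤ k)
    {G : Hypergraph V} (hG : G.IsSupertree k) : ∃ E, G = ofEdges E ∧ IsHypertree k E := by
  obtain ⟨E, rfl⟩ := exists_eq_ofEdges hG.vertexSet_eq
  exact ⟨E, rfl, (isSupertree_ofEdges hk).1 hG⟩

lemma exists_perm_degree {G H : Hypergraph (Fin n)} (hG : G ∈ supertreesWithDegrees k d)
    (hH : H ∈ supertreesWithDegrees k d) :
    ∃ σ : Equiv.Perm (Fin n), ∀ v, H.degree (σ v) = G.degree v := by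
  obtain ⟨-, σ, hσ⟩ := hG
  obtain ⟨-, τ, hτ⟩ := hH
  refine ⟨σ.symm.trans τ, fun v => ?_⟩
  rw [Equiv.trans_apply, hτ, ← hσ, σ.apply_symm_apply]

lemma finite_supertreesWithDegrees : (supertreesWithDegrees k d).Finite := by
  refine (Set.finite_range (ofEdges (V := Fin n))).subset fun G hG => ?_
  obtain ⟨E, rfl⟩ := exists_eq_ofEdges hG.1.vertexSet_eq
  exact ⟨E, rfl⟩

lemma isGreatest_signlessLaplacianRadius (hk : 2 ≤ k) {G : Hypergraph (Fin n)}
    (hG : G.IsSupertree k) : IsGreatest (Tensor.eigenvalueModuli (G.signlessLaplacian k))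
      (G.signlessLaplacianRadius k) := by
  obtain ⟨E, rfl, hE⟩ := exists_isHypertree_of_isSupertree hk hG
  have := hG.nonempty
  obtain ⟨ρ, x, h⟩ := exists_isPerronPair (by omega) hE.card_eq hE.connected
  rw [h.radius_eq (by omega) hE.card_eq]
  exact h.isGreatest (by omega) hE.card_eq

lemma hasBFSOrdering_of_forall_radius_le (hk : 2 ≤ k) {G : Hypergraph (Fin n)}
    (hG : G ∈ supertreesWithDegrees k d) (hmax : ∀ H ∈ supertreesWithDegrees k d,
      H.signlessLaplacianRadius k ≤ G.signlessLaplacianRadius k) : G.HasBFSOrdering := by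
  have := hG.1.nonempty
  obtain ⟨E, rfl, hE⟩ := exists_isHypertree_of_isSupertree hk hG.1
  have hk0 : k ≠ 0 := by omega
  obtain ⟨ρ, x, h⟩ := exists_isPerronPair hk0 hE.card_eq hE.connected
  refine (h.isExtremal hk0 hE fun E' hE' hσ ρ' x' h' => ?_).hasBFSOrdering hk
  rw [← h.radius_eq hk0 hE.card_eq, ← h'.radius_eq hk0 hE'.card_eq]
  refine hmax _ ⟨(isSupertree_ofEdges hk).2 hE', ?_⟩
  obtain ⟨σ, hσ⟩ := hσ
  obtain ⟨-, τ, hτ⟩ := hG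
  refine ⟨τ.trans σ, fun i => ?_⟩
  rw [← hτ, degree_ofEdges, degree_ofEdges]
  exact hσ (τ i)

/-- Renumber each tree along its ordering, so that both orderings become `<`; the renumbered trees
coincide. -/
lemma isomorphic_of_hasBFSOrdering (hk : 2 ≤ k) {G H : Hypergraph (Fin n)}
    (hG : G ∈ supertreesWithDegrees k d) (hH : H ∈ supertreesWithDegrees k d)
    (hGb : G.HasBFSOrdering) (hHb : H.HasBFSOrdering) : G.Isomorphic H := by
  obtain ⟨π, hπ⟩ := exists_perm_degree hG hH
  obtain ⟨a, r, hr⟩ := hGb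
  obtain ⟨b, s, hs⟩ := hHb
  have := hr.wellOrder
  have := hs.wellOrder
  obtain ⟨σ, hσ⟩ := exists_equiv_fin_of_isWellOrder (Fintype.card_fin n) r
  obtain ⟨τ, hτ⟩ := exists_equiv_fin_of_isWellOrder (Fintype.card_fin n) s
  obtain ⟨E, hE, hE'⟩ := exists_isHypertree_of_isSupertree hk (hG.1.image σ)
  obtain ⟨F, hF, hF'⟩ := exists_isHypertree_of_isSupertree hk (hH.1.image τ)
  have h1 := hr.image σ hσ
  have h2 := hs.image τ hτ
  rw [hE] at h1
  rw [hF] at h2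
  have h3 : E = F := by
    refine eq_of_isBFSOrdering_lt hk hE' hF' h1 h2 ⟨(σ.symm.trans π).trans τ, fun v => ?_⟩
    rw [deg, deg, ← degree_ofEdges, ← degree_ofEdges, ← hE, ← hF]
    obtain ⟨v, rfl⟩ := σ.surjective v
    rw [degree_image]
    simp only [Equiv.trans_apply, σ.symm_apply_apply]
    rw [degree_image, hπ]
  refine ⟨σ.trans τ.symm, ?_⟩
  rw [← image_equiv_symm H τ, hF, ← h3, ← hE, image_image]
  rfl

end Supertrees

end Hypergraph

theorem theorem4p8 (k n : ℕ) (hk : 2 ≤ k) (d : Fin n → ℕ)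
    (hd : (Hypergraph.supertreesWithDegrees k d).Nonempty) :
    -- the spectral radii of the supertrees in question are attained maxima
    (∀ G ∈ Hypergraph.supertreesWithDegrees k d,
      IsGreatest (Hypergraph.Tensor.eigenvalueModuli (G.signlessLaplacian k))
        (G.signlessLaplacianRadius k)) ∧
    -- the BFS-supertree exists, is unique up to isomorphism, and is the unique maximizer
    ∃ Gstar ∈ Hypergraph.supertreesWithDegrees k d,
      Gstar.HasBFSOrdering ∧
      (∀ G ∈ Hypergraph.supertreesWithDegrees k d, G.HasBFSOrdering → G.Isomorphic Gstar) ∧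
      ∀ G ∈ Hypergraph.supertreesWithDegrees k d,
        G.signlessLaplacianRadius k ≤ Gstar.signlessLaplacianRadius k ∧
        (G.signlessLaplacianRadius k = Gstar.signlessLaplacianRadius k ↔
          G.Isomorphic Gstar) := by
  refine ⟨fun G hG => Hypergraph.isGreatest_signlessLaplacianRadius hk hG.1, ?_⟩
  -- The tree with a breadth-first-search ordering is found as a maximizer of the radius, not
  -- constructed.
  obtain ⟨Gstar, hGstar, hmax⟩ := Set.exists_max_image _
    (fun G : Hypergraph (Fin n) => G.signlessLaplacianRadius k)
    Hypergraph.finite_supertreesWithDegrees hd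
  have hbfs := Hypergraph.hasBFSOrdering_of_forall_radius_le hk hGstar hmax
  refine ⟨Gstar, hGstar, hbfs, fun G hG hGb =>
    Hypergraph.isomorphic_of_hasBFSOrdering hk hG hGstar hGb hbfs, fun G hG => ⟨hmax G hG,
      fun heq => ?_, fun hiso => hiso.radius_eq k⟩⟩
  refine Hypergraph.isomorphic_of_hasBFSOrdering hk hG hGstar ?_ hbfs
  exact Hypergraph.hasBFSOrdering_of_forall_radius_le hk hG fun H hH => by
    rw [heq]; exact hmax H hH
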